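/- Let $\mathcal S,\mathcal A$ be finite, $|\mathcal A|\ge 2$, $\gamma\in(0,1)$, $\lambda\ge 0$, and let $\Pi\subset\mathbb R^{|\mathcal S||\mathcal A|}$ be the set of policies $\pi$ (entries $\pi(a|s)\in[0,1]$, $\sum_a\pi(a|s)=1$ for all $s$), with the Euclidean norm, and $\Pi_\Delta=\{\pi\in\Pi:\pi(a|s)\ge\Delta\ \forall s,a\}$. Each policy $\pi$ induces a transition kernel $p_\pi$ and a reward $r_\pi\in[0,1]^{|\mathcal S||\mathcal A|}$, and $\rho$ is an initial state distribution. Assume that for all $\pi,\pi'\in\Pi$: $\|p_{\pi'}-p_\pi\|\le\epsilon_p\|\pi'-\pi\|$, $\|r_{\pi'}-r_\pi\|\le\epsilon_r\|\pi'-\pi\|$, and the entries of $p_\pi$ and $r_\pi$ are differentiable in $\pi$ with $\|\nabla_\pi p_{\pi'}(s'|s,a)-\nabla_\pi p_\pi(s'|s,a)\|\le S_p\|\pi'-\pi\|$ and $\|\nabla_\pi r_{\pi'}(s,a)-\nabla_\pi r_\pi(s,a)\|\le S_r\|\pi'-\pi\|$. Let $$V(\pi)=\mathbb E\Big[\sum_{t\ge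 0}\gamma^t\big(r_\pi(s_t,a_t)-\lambda\log\pi(a_t|s_t)\big)\Big],\qquad s_0\sim\rho,\ a_t\sim\pi(\cdot|s_t),\ s_{t+1}\sim p_\pi(\cdot|s_t,a_t),$$ $\mathcal L_0=\{u\in\mathbb R^{|\mathcal S||\mathcal A|}:\sum_a u(a|s)=0\ \forall s\}$ and $U_1=\{u:\|u\|=1\}$. Let $\Delta>\delta>0$, $\eta\in(0,1)$, $\pi\in\Pi_\Delta$, $N\ge 1$, $\epsilon_V\ge 0$. Let $u_1,\dots,u_N$ be i.i.d. uniform on $U_1\cap\mathcal L_0$, and let $\hat V$ be a randomized policy evaluation with $|\hat V(\pi')-V(\pi')|\le\epsilon_V$ with probability at least $1-\frac{\eta}{3N}$ for each fixed $\pi'\in\Pi$, the randomness of each of its runs being independent of the direction at which it is run. Put $$\hat g=\frac{|\mathcal S|(|\mathcal A|-1)}{2N\delta}\sum_{i=1}^N\big(\hat V(\pi+\delta u_i)-\hat V(\pi-\delta u_i)\big)u_i .$$ Then $\pi\pm\delta u\in\Pi$ for every $u\in U_1\cap\mathcal L_0$, so $\hat g$ is well defined; $V$ is differentiable at $\pi$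 within $\Pi$; and with probability at least $1-\eta$, $$\|\hat g-\mathrm{proj}_{\mathcal L_0}(\nabla_\pi V(\pi))\|\le\frac{2|\mathcal S||\mathcal A|\epsilon_V}{\delta}+\frac{4L|\mathcal S||\mathcal A|}{3N(\Delta-\delta)}\log\frac{3N|\mathcal S||\mathcal A|}{\eta}+\frac{L|\mathcal S||\mathcal A|}{\Delta-\delta}\sqrt{\frac2N\log\frac{3N|\mathcal S||\mathcal A|}{\eta}}+\frac{\delta\ell}{\Delta-\delta},$$ where $L,\ell>0$ depend only on $|\mathcal S|,|\mathcal A|,\gamma,\lambda,\epsilon_p,\epsilon_r,S_p,S_r$. Moreover, whenever $N\ge 2\eta$ (in particular for all $N\ge 2$), the right-hand side is at most $\frac{C}{\Delta-\delta}\big(\frac{\epsilon_V}{\delta}+\frac{\log(N/\eta)}{\sqrt N}+\delta\big)$ with $C>0$ depending only on the same parameters. -/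

import Mathlib

open MeasureTheory ProbabilityTheory

noncomputable section

namespace PerfRL

variable (S A : Type*) [Fintype S] [Fintype A]

/-- Vectors indexed by state-action pairs, with the Euclidean norm; the entry `π(a|s)` is
`π (s, a)`. -/
abbrev PolicyVec : Type _ := EuclideanSpace ℝ (S × A)

/-- Vectors indexed by triples `(s, a, s')`, with the Euclidean norm; the entry `p(s'|s,a)` is
`p (s, a, s')`. -/
abbrev KernelVec : Type _ := EuclideanSpace ℝ (S × A × S)

/-- The policy space `Π`. -/
def policySet : Set (PolicyVec S A) :=
  {π | (∀ x, π x ∈ Set.Icc (0 : ℝ) 1) ∧ ∀ s, ∑ a, π (s, a) = 1}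

/-- The policy subspace `Π_Δ`: policies all of whose entries are at least `Δ`. -/
def policySubset (Δ : ℝ) : Set (PolicyVec S A) :=
  {π | π ∈ policySet S A ∧ ∀ x, Δ ≤ π x}

/-- The space of transition kernels. -/
def transitionSet : Set (KernelVec S A) :=
  {p | (∀ x, p x ∈ Set.Icc (0 : ℝ) 1) ∧ ∀ s a, ∑ s', p (s, a, s') = 1}

/-- The space of rewards. -/
def rewardSet : Set (PolicyVec S A) := {r | ∀ x, r x ∈ Set.Icc (0 : ℝ) 1}

/-- The space of distributions on the state space. -/
def stateDistSet : Set (EuclideanSpace ℝ S) :=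
  {ρ | (∀ s, ρ s ∈ Set.Icc (0 : ℝ) 1) ∧ ∑ s, ρ s = 1}

/-- The linear subspace `L₀` of vectors with `∑ a, u(a|s) = 0` for every state `s`. -/
def zeroRowSum : Submodule ℝ (PolicyVec S A) where
  carrier := {u | ∀ s, ∑ a, u (s, a) = 0}
  zero_mem' := by intro s; simp
  add_mem' := by
    intro u v hu hv s
    simp only [PiLp.add_apply, Finset.sum_add_distrib]
    rw [hu s, hv s, add_zero]
  smul_mem' := by
    intro c u hu s
    simp only [PiLp.smul_apply, smul_eq_mul, ← Finset.mul_sum]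
    rw [hu s, mul_zero]

/-- The unit sphere of `L₀`, inside the space of all state-action vectors. -/
def unitDirections : Set (PolicyVec S A) := {u | ‖u‖ = 1 ∧ u ∈ zeroRowSum S A}

/-- The surface measure of the unit sphere of the Euclidean space `L₀`, induced by the Lebesgue
measure of `L₀` (the Haar measure normalized on an orthonormal basis). -/
def sphereSurface : Measure (Metric.sphere (0 : zeroRowSum S A) 1) :=
  ((stdOrthonormalBasis ℝ (zeroRowSum S A)).toBasis.addHaar).toSphere

/-- The uniform distribution on the unit sphere of `L₀`: normalized surface measure, regarded as a
measure on the space of all state-action vectors. -/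
def uniformDirection : Measure (PolicyVec S A) :=
  ((sphereSurface S A Set.univ)⁻¹ • sphereSurface S A).map
    (fun u : Metric.sphere (0 : zeroRowSum S A) 1 => ((u : zeroRowSum S A) : PolicyVec S A))

/-- A performative Markov decision process on finite state and action spaces: a transition kernel
and a reward that depend on the policy, and an initial state distribution. Only the values of `p`
and `r` at policies matter. -/
structure PerformativeMDP where
  p : PolicyVec S A → KernelVec S A
  r : PolicyVec S A → PolicyVec S A
  ρ : EuclideanSpace ℝ S
  p_mem : ∀ π ∈ policySet S A, p π ∈ transitionSet S A
  r_mem : ∀ π ∈ policySet S A, r π ∈ rewardSet S A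
  ρ_mem : ρ ∈ stateDistSet S

variable {S A}

section Trajectories

variable [MeasurableSpace S] [MeasurableSpace A]

/-- The law of `(s₀, a₀)`: `s₀ ∼ ρ` and `a₀ ∼ π(·|s₀)`. -/
def initialLaw (ρ : stateDistSet S) (π : policySet S A) : Measure (S × A) :=
  ∑ y : S × A, ENNReal.ofReal (ρ.1 y.1 * π.1 y) • Measure.dirac y

/-- The conditional law of `(s_{t+1}, a_{t+1})` given `(s_t, a_t) = x`:
`s_{t+1} ∼ p(·|s_t,a_t)` and `a_{t+1} ∼ π(·|s_{t+1})`. -/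
def stepLaw (π : policySet S A) (p : transitionSet S A) (x : S × A) : Measure (S × A) :=
  ∑ y : S × A, ENNReal.ofReal (p.1 (x.1, x.2, y.1) * π.1 y) • Measure.dirac y

theorem initialLaw_univ (ρ : stateDistSet S) (π : policySet S A) :
    initialLaw ρ π Set.univ = 1 := by
  have h0 : ∀ y : S × A, 0 ≤ ρ.1 y.1 * π.1 y := fun y =>
    mul_nonneg (ρ.2.1 _).1 (π.2.1 _).1
  simp only [initialLaw, Measure.coe_finsetSum, Finset.sum_apply, Measure.smul_apply,
    measure_univ, smul_eq_mul, mul_one]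
  rw [← ENNReal.ofReal_sum_of_nonneg (fun y _ => h0 y), Fintype.sum_prod_type]
  simp only [← Finset.mul_sum, π.2.2, mul_one, ρ.2.2, ENNReal.ofReal_one]

theorem stepLaw_univ (π : policySet S A) (p : transitionSet S A) (x : S × A) :
    stepLaw π p x Set.univ = 1 := by
  have h0 : ∀ y : S × A, 0 ≤ p.1 (x.1, x.2, y.1) * π.1 y := fun y =>
    mul_nonneg (p.2.1 _).1 (π.2.1 _).1
  simp only [stepLaw, Measure.coe_finsetSum, Finset.sum_apply, Measure.smul_apply,
    measure_univ, smul_eq_mul, mul_one]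
  rw [← ENNReal.ofReal_sum_of_nonneg (fun y _ => h0 y), Fintype.sum_prod_type]
  simp only [← Finset.mul_sum, π.2.2, mul_one, p.2.2, ENNReal.ofReal_one]

variable [MeasurableSingletonClass S] [MeasurableSingletonClass A]

/-- The Markov kernel of the state-action chain. -/
def stepKernel (π : policySet S A) (p : transitionSet S A) : Kernel (S × A) (S × A) :=
  Kernel.ofFunOfCountable (stepLaw π p)

instance stepKernel_isMarkovKernel (π : policySet S A) (p : transitionSet S A) :
    IsMarkovKernel (stepKernel π p) :=
  ⟨fun x => ⟨stepLaw_univ π p x⟩⟩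

/-- The step at time `n + 1` as a kernel from histories up to time `n`; it only looks at the last
state-action pair. -/
def historyKernel (π : policySet S A) (p : transitionSet S A) (n : ℕ) :
    Kernel (Finset.Iic n → S × A) (S × A) :=
  (stepKernel π p).comap (fun h => h ⟨n, Finset.mem_Iic.2 le_rfl⟩) (measurable_pi_apply _)

instance historyKernel_isMarkovKernel (π : policySet S A) (p : transitionSet S A) (n : ℕ) :
    IsMarkovKernel (historyKernel π p n) := by
  unfold historyKernel; infer_instance

/-- The law of the trajectory `(s_t, a_t)_{t ≥ 0}` when the policy `π` is applied in an
environment with transition kernel `p` and initial state distribution `ρ`. -/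
def trajectoryLaw (ρ : stateDistSet S) (π : policySet S A) (p : transitionSet S A) :
    Measure (ℕ → S × A) :=
  Kernel.trajMeasure (X := fun _ => S × A) (initialLaw ρ π) (historyKernel π p)

/-- The entropy-regularized value function: the expectation of
`∑ t, γ ^ t * (r(s_t, a_t) - lam * log π(a_t|s_t))`. Almost surely only actions with
`π(a_t|s_t) > 0` are taken. -/
def regValue (γ lam : ℝ) (ρ : stateDistSet S) (π : policySet S A) (p : transitionSet S A)
    (r : PolicyVec S A) : ℝ :=
  ∫ x, ∑' t : ℕ, γ ^ t * (r (x t) - lam * Real.log (π.1 (x t))) ∂(trajectoryLaw ρ π p)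

namespace PerformativeMDP

variable (M : PerformativeMDP S A)

/-- The value of applying the policy `π` to the environment induced by the policy `π'`. -/
def value (γ lam : ℝ) (π' π : policySet S A) : ℝ :=
  regValue γ lam ⟨M.ρ, M.ρ_mem⟩ π ⟨M.p π'.1, M.p_mem π'.1 π'.2⟩ (M.r π'.1)

open Classical in
/-- The performative value function `π ↦ V_{λ,π}^π` on the policy space (and `0` elsewhere, so that
it can be differentiated within the policy space). -/
def perfValue (γ lam : ℝ) (π : PolicyVec S A) : ℝ :=
  if h : π ∈ policySet S A then M.value γ lam ⟨π, h⟩ ⟨π, h⟩ else 0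

end PerformativeMDP

end Trajectories

namespace PerformativeMDP

variable (M : PerformativeMDP S A)

/-- Sensitivity: `p` and `r` are Lipschitz in the policy. -/
def Sensitive (εp εr : ℝ) : Prop :=
  ∀ π ∈ policySet S A, ∀ π' ∈ policySet S A,
    ‖M.p π' - M.p π‖ ≤ εp * ‖π' - π‖ ∧ ‖M.r π' - M.r π‖ ≤ εr * ‖π' - π‖

/-- Smoothness: the entries of `p` and `r` are differentiable on the policy space, with gradients
that are Lipschitz in the policy. A gradient within the policy space is only determined up to a
vector orthogonal to `L₀`; any Lipschitz choice will do. -/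
def Smooth (Sp Sr : ℝ) : Prop :=
  (∀ x : S × A × S, ∃ G : PolicyVec S A → PolicyVec S A,
    (∀ π ∈ policySet S A,
      HasGradientWithinAt (fun π => M.p π x) (G π) (policySet S A) π) ∧
    ∀ π ∈ policySet S A, ∀ π' ∈ policySet S A, ‖G π' - G π‖ ≤ Sp * ‖π' - π‖) ∧
  (∀ x : S × A, ∃ G : PolicyVec S A → PolicyVec S A,
    (∀ π ∈ policySet S A,
      HasGradientWithinAt (fun π => M.r π x) (G π) (policySet S A) π) ∧
    ∀ π ∈ policySet S A, ∀ π' ∈ policySet S A, ‖G π' - G π‖ ≤ Sr * ‖π' - π‖)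

end PerformativeMDP

/-- The two-point zeroth-order gradient estimator with directions `u i`, where `vp i` and `vm i`
are the estimated values at the policies `π + δ u_i` and `π - δ u_i`. -/
def twoPointEstimator {N : ℕ} (δ : ℝ) (u : Fin N → PolicyVec S A) (vp vm : Fin N → ℝ) :
    PolicyVec S A :=
  ((Fintype.card S : ℝ) * ((Fintype.card A : ℝ) - 1) / (2 * N * δ)) •
    ∑ i, (vp i - vm i) • u i

/-- The full expression of the error bound, in terms of the Lipschitz constant `L` and the
smoothness constant `l`. -/
def errorBound (S A : Type*) [Fintype S] [Fintype A] (L l Δ δ εV η : ℝ) (N : ℕ) : ℝ :=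
  2 * Fintype.card S * Fintype.card A * εV / δ
    + 4 * L * Fintype.card S * Fintype.card A / (3 * N * (Δ - δ))
        * Real.log (3 * N * Fintype.card S * Fintype.card A / η)
    + L * Fintype.card S * Fintype.card A / (Δ - δ)
        * √(2 / N * Real.log (3 * N * Fintype.card S * Fintype.card A / η))
    + δ * l / (Δ - δ)

end PerfRL

end

namespace PerfRL

/-! ### Trajectory law and the Bellman equation -/

section Trajectories

variable {S A : Type*} [Fintype S] [Fintype A] [MeasurableSpace S] [MeasurableSpace A]
  [MeasurableSingletonClass S] [MeasurableSingletonClass A]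

/-! A smoothness estimate for `V` is combined with a concentration estimate for averages over the
sphere of `L₀`.

Smoothness. `V(π) = ⟨ρ, W⟩`, where `W = b + γ P W` and `b`, `P` are the reward (entropy included)
and the transition matrix averaged over actions. Since `P` is stochastic, `(1 - γP)⁻¹` has sup-norm
at most `1/(1-γ)`, so first- and second-order perturbation bounds on `b` and `P` pass to `W`. Those
bounds come from the product rule for `π·r`, `π·p` and from `-x log x`, which on `[m, 1]` has
derivative at most `1/m` in absolute value and linearization error at most `(y-x)²/m`. Hence on
`Π_m` the value is `K/m`-Lipschitz and has a linearization with error `Q/m · ‖π'-π‖²`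
(`exists_perfValue_expansion`). With `m = Δ - δ` this covers every `π ± δu`.

Sphere. Reflection invariance makes the second moment of a uniform direction isotropic, so `E[⟨g,u⟩
u] = proj g / d` with `d = dim L₀ = |S|(|A|-1)` (`integral_inner_mul_apply`). As `V(π+δu) - V(π-δu)
= 2δ⟨g,u⟩ + O(δ²/m)`, the vector `d/(2δ) · (V(π+δu) - V(π-δu)) u` has mean `proj g` up to a bias
`O(δ/m)`, and its entries are at most `dK/m` by the Lipschitz bound. Hoeffding's inequality in each
coordinate controls the average of `N` copies. Accuracy of `Vhat` at fixed policies carries over to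
random ones by independence and Fubini (`measure_evaluation_error_le`). The evaluations at `+`,
those at `-`, and the coordinates each get failure probability `η/3`.

With `n = |S||A|`, Hoeffding produces `log(6n/η)`, at most twice `log(3Nn/η)`; the square-root term
alone therefore absorbs the fluctuation, and the `1/N` term of `errorBound` is slack. -/

theorem integral_sum_ofReal_smul_dirac {X : Type*} [Fintype X] [MeasurableSpace X]
    [MeasurableSingletonClass X] (w : X → ℝ) (hw : ∀ x, 0 ≤ w x) (f : X → ℝ) :
    ∫ x, f x ∂(∑ y : X, ENNReal.ofReal (w y) • Measure.dirac y) = ∑ y, w y * f y := by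
  have : ∀ y ∈ (Finset.univ : Finset X),
      Integrable f (ENNReal.ofReal (w y) • Measure.dirac y) := by
    intro y _
    refine Integrable.smul_measure ?_ ENNReal.ofReal_ne_top
    exact Integrable.of_finite
  rw [integral_finsetSum_measure this]
  refine Finset.sum_congr rfl fun y _ => ?_
  rw [integral_smul_measure, integral_dirac, ENNReal.toReal_ofReal (hw y), smul_eq_mul]

theorem integral_initialLaw (ρ : stateDistSet S) (π : policySet S A) (f : S × A → ℝ) :
    ∫ x, f x ∂(initialLaw ρ π) = ∑ y : S × A, ρ.1 y.1 * π.1 y * f y :=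
  integral_sum_ofReal_smul_dirac _ (fun _ => mul_nonneg (ρ.2.1 _).1 (π.2.1 _).1) f

theorem integral_stepLaw (π : policySet S A) (p : transitionSet S A) (x : S × A)
    (f : S × A → ℝ) :
    ∫ y, f y ∂(stepLaw π p x) = ∑ y : S × A, p.1 (x.1, x.2, y.1) * π.1 y * f y :=
  integral_sum_ofReal_smul_dirac _ (fun _ => mul_nonneg (p.2.1 _).1 (π.2.1 _).1) f

instance initialLaw_isProbabilityMeasure (ρ : stateDistSet S) (π : policySet S A) :
    IsProbabilityMeasure (initialLaw ρ π) :=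
  ⟨initialLaw_univ ρ π⟩

instance trajectoryLaw_isProbabilityMeasure (ρ : stateDistSet S) (π : policySet S A)
    (p : transitionSet S A) : IsProbabilityMeasure (trajectoryLaw ρ π p) := by
  unfold trajectoryLaw
  infer_instance

theorem map_frestrictLe_zero_trajMeasure {X : ℕ → Type*} [∀ n, MeasurableSpace (X n)]
    (μ₀ : Measure (X 0)) [IsProbabilityMeasure μ₀]
    (κ : (n : ℕ) → Kernel (Π i : Finset.Iic n, X i) (X (n + 1))) [∀ n, IsMarkovKernel (κ n)] :
    (Kernel.trajMeasure μ₀ κ).map (fun x => x 0) = μ₀ := by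
  let e : (Π i : Finset.Iic 0, X i) → X 0 := fun h => h ⟨0, Finset.mem_Iic.2 le_rfl⟩
  have he : Measurable e := measurable_pi_apply _
  change (Kernel.trajMeasure μ₀ κ).map (e ∘ Preorder.frestrictLe 0) = μ₀
  rw [← Measure.map_map he (by fun_prop), Kernel.trajMeasure,
    Measure.map_comp _ _ (by fun_prop), Kernel.traj_map_frestrictLe, Kernel.partialTraj_self,
    Measure.id_comp]
  exact (Measure.map_map he (MeasurableEquiv.measurable
    (MeasurableEquiv.piUnique (fun i : Finset.Iic 0 => X i)).symm)).trans Measure.map_id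

theorem integral_trajectoryLaw_zero (ρ : stateDistSet S) (π : policySet S A)
    (p : transitionSet S A) (f : S × A → ℝ) :
    ∫ x, f (x 0) ∂(trajectoryLaw ρ π p) = ∑ y : S × A, ρ.1 y.1 * π.1 y * f y := by
  rw [← integral_initialLaw,
    ← map_frestrictLe_zero_trajMeasure (X := fun _ => S × A) (initialLaw ρ π)
      (historyKernel π p),
    integral_map (measurable_pi_apply 0).aemeasurable (by fun_prop)]
  rfl

theorem integral_trajectoryLaw_succ (ρ : stateDistSet S) (π : policySet S A)
    (p : transitionSet S A) (f : S × A → ℝ) (n : ℕ) :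
    ∫ x, f (x (n + 1)) ∂(trajectoryLaw ρ π p) =
      ∫ x, (∑ y : S × A, p.1 ((x n).1, (x n).2, y.1) * π.1 y * f y)
        ∂(trajectoryLaw ρ π p) := by
  have hm : Measurable f := measurable_of_finite f
  have key := Kernel.map_frestrictLe_trajMeasure_compProd_eq_map_trajMeasure
    (X := fun _ => S × A) (μ₀ := initialLaw ρ π) (κ := historyKernel π p) (a := n)
  have h1 : ∫ x, f (x (n + 1)) ∂(trajectoryLaw ρ π p) =
      ∫ z, f z.2 ∂((trajectoryLaw ρ π p).map
        (fun x ↦ (Preorder.frestrictLe (π := fun _ => S × A) n x, x (n + 1)))) := by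
    rw [integral_map (by fun_prop) (by fun_prop)]
  rw [h1]
  unfold trajectoryLaw
  rw [← key]
  have : IsProbabilityMeasure
      ((Kernel.trajMeasure (X := fun _ => S × A) (initialLaw ρ π) (historyKernel π p)).map
        (Preorder.frestrictLe (π := fun _ => S × A) n)) :=
    Measure.isProbabilityMeasure_map (by fun_prop)
  rw [Measure.integral_compProd, integral_map (by fun_prop) (by fun_prop)]
  · refine integral_congr_ae (Filter.Eventually.of_forall fun x => ?_)
    exact integral_stepLaw π p (x n) f
  · obtain ⟨C, hC⟩ := (Set.finite_range (fun x => ‖f x‖)).bddAbove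
    refine Integrable.of_bound (by fun_prop) C (Filter.Eventually.of_forall fun x => ?_)
    exact hC ⟨_, rfl⟩

/-- A solution of the Bellman equation for state-action pairs computes the value function. -/
theorem regValue_eq_of_bellman {γ lam : ℝ} (hγ0 : 0 ≤ γ) (hγ1 : γ < 1) (ρ : stateDistSet S)
    (π : policySet S A) (p : transitionSet S A) (r : PolicyVec S A) (Z : S × A → ℝ)
    (hZ : ∀ x : S × A, Z x = r x - lam * Real.log (π.1 x)
      + γ * ∑ y : S × A, p.1 (x.1, x.2, y.1) * π.1 y * Z y) :
    regValue γ lam ρ π p r = ∑ y : S × A, ρ.1 y.1 * π.1 y * Z y := by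
  set c : S × A → ℝ := fun x => r x - lam * Real.log (π.1 x) with hc
  obtain ⟨C, hC⟩ := (Set.finite_range (fun x => ‖c x‖)).bddAbove
  obtain ⟨D, hD⟩ := (Set.finite_range (fun x => ‖Z x‖)).bddAbove
  have hC' : ∀ x, ‖c x‖ ≤ C := fun x => hC ⟨x, rfl⟩
  have hD' : ∀ x, ‖Z x‖ ≤ D := fun x => hD ⟨x, rfl⟩
  set μ := trajectoryLaw ρ π p with hμ
  have hint : ∀ (f : S × A → ℝ) (t : ℕ), Integrable (fun x : ℕ → S × A => f (x t)) μ := by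
    intro f t
    have hm : Measurable f := measurable_of_finite f
    obtain ⟨C, hC⟩ := (Set.finite_range (fun x => ‖f x‖)).bddAbove
    exact Integrable.of_bound (hm.comp (measurable_pi_apply t)).aestronglyMeasurable C
      (Filter.Eventually.of_forall fun x => hC ⟨_, rfl⟩)
  have hbound : ∀ (f : S × A → ℝ) (B : ℝ) (_ : ∀ x, ‖f x‖ ≤ B) (t : ℕ),
      ‖∫ x, f (x t) ∂μ‖ ≤ B := by
    intro f B hB t
    have := norm_integral_le_of_norm_le_const (μ := μ)
      (Filter.Eventually.of_forall fun x : ℕ → S × A => hB (x t))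
    simpa using this
  have hsum : HasSum (fun t => ∫ x, γ ^ t * c (x t) ∂μ) (regValue γ lam ρ π p r) := by
    refine hasSum_integral_of_summable_integral_norm (fun t => (hint c t).const_mul _) ?_
    refine Summable.of_nonneg_of_le (fun t => integral_nonneg fun _ => norm_nonneg _)
      (fun t => ?_) ((summable_geometric_of_lt_one hγ0 hγ1).mul_right C)
    have h := hbound (fun y => ‖γ ^ t * c y‖) (γ ^ t * C) (fun y => by
      rw [norm_norm, norm_mul, Real.norm_of_nonneg (pow_nonneg hγ0 t)]
      exact mul_le_mul_of_nonneg_left (hC' y) (pow_nonneg hγ0 t)) t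
    exact (le_abs_self _).trans h
  -- Integrating the Bellman equation against the law at time `t` makes the discounted rewards
  -- telescope.
  have hstep : ∀ t, ∫ x, c (x t) ∂μ = ∫ x, Z (x t) ∂μ - γ * ∫ x, Z (x (t + 1)) ∂μ := by
    intro t
    rw [integral_trajectoryLaw_succ, ← integral_const_mul, ← integral_sub (hint Z t)]
    · refine integral_congr_ae (Filter.Eventually.of_forall fun x => ?_)
      simp only
      rw [hZ (x t)]
      ring
    · exact (hint (fun z => ∑ y : S × A, p.1 (z.1, z.2, y.1) * π.1 y * Z y) t).const_mul γ
  have hpartial : ∀ n, ∑ t ∈ Finset.range n, ∫ x, γ ^ t * c (x t) ∂μ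
      = ∫ x, Z (x 0) ∂μ - γ ^ n * ∫ x, Z (x n) ∂μ := by
    intro n
    induction n with
    | zero => simp
    | succ n ih =>
      rw [Finset.sum_range_succ, ih, integral_const_mul, hstep n]
      ring
  have hlim : Filter.Tendsto (fun n => γ ^ n * ∫ x, Z (x n) ∂μ) Filter.atTop (nhds 0) := by
    refine squeeze_zero_norm (a := fun n => γ ^ n * D) (fun n => ?_) ?_
    · rw [norm_mul, Real.norm_of_nonneg (pow_nonneg hγ0 n)]
      exact mul_le_mul_of_nonneg_left (hbound Z D hD' n) (pow_nonneg hγ0 n)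
    · simpa using (tendsto_pow_atTop_nhds_zero_of_lt_one hγ0 hγ1).mul_const D
  have h1 := hsum.tendsto_sum_nat
  simp only [hpartial] at h1
  have h2 : Filter.Tendsto (fun n => ∫ x, Z (x 0) ∂μ - γ ^ n * ∫ x, Z (x n) ∂μ)
      Filter.atTop (nhds (∫ x, Z (x 0) ∂μ)) := by
    simpa using hlim.const_sub (∫ x, Z (x 0) ∂μ)
  rw [tendsto_nhds_unique h1 h2, integral_trajectoryLaw_zero]

end Trajectories

end PerfRL

namespace PerfRL

/-! ### Sup-norm perturbation theory of the Bellman equation -/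

section Resolvent

open Matrix

variable {S : Type*} [Fintype S]

theorem norm_mulVec_le_of_stochastic {P : Matrix S S ℝ} (h0 : ∀ i j, 0 ≤ P i j)
    (h1 : ∀ i, ∑ j, P i j = 1) (v : S → ℝ) : ‖P *ᵥ v‖ ≤ ‖v‖ := by
  rw [pi_norm_le_iff_of_nonneg (norm_nonneg _)]
  intro i
  calc ‖(P *ᵥ v) i‖ ≤ ∑ j, ‖P i j * v j‖ := norm_sum_le _ _
    _ ≤ ∑ j, P i j * ‖v‖ := by
        refine Finset.sum_le_sum fun j _ => ?_
        rw [norm_mul, Real.norm_of_nonneg (h0 i j)]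
        exact mul_le_mul_of_nonneg_left (norm_le_pi_norm v j) (h0 i j)
    _ = ‖v‖ := by rw [← Finset.sum_mul, h1, one_mul]

theorem norm_mulVec_le_card {P : Matrix S S ℝ} {a : ℝ} (ha : 0 ≤ a) (h : ∀ i j, |P i j| ≤ a)
    (v : S → ℝ) : ‖P *ᵥ v‖ ≤ Fintype.card S * a * ‖v‖ := by
  rw [pi_norm_le_iff_of_nonneg (by positivity)]
  intro i
  calc ‖(P *ᵥ v) i‖ ≤ ∑ j, ‖P i j * v j‖ := norm_sum_le _ _
    _ ≤ ∑ _j : S, a * ‖v‖ := by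
        refine Finset.sum_le_sum fun j _ => ?_
        rw [norm_mul]
        exact mul_le_mul (h i j) (norm_le_pi_norm v j) (norm_nonneg _) ha
    _ = Fintype.card S * a * ‖v‖ := by
        rw [Finset.sum_const, Finset.card_univ, nsmul_eq_mul, mul_assoc]

/-- Averaging against a stochastic matrix does not increase the sup-norm, so `‖e‖ ≤ ‖f‖ + γ‖e‖`.
This one estimate yields invertibility of `1 - γP`, boundedness of solutions and both perturbation
bounds. -/
theorem norm_le_of_eq_add_smul_mulVec {P : Matrix S S ℝ} (h0 : ∀ i j, 0 ≤ P i j)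
    (h1 : ∀ i, ∑ j, P i j = 1) {γ : ℝ} (hγ0 : 0 ≤ γ) (hγ1 : γ < 1) {e f : S → ℝ}
    (h : e = f + γ • (P *ᵥ e)) : ‖e‖ ≤ ‖f‖ / (1 - γ) := by
  have h2 : ‖e‖ ≤ ‖f‖ + γ * ‖e‖ := by
    calc ‖e‖ = ‖f + γ • (P *ᵥ e)‖ := by rw [← h]
      _ ≤ ‖f‖ + ‖γ • (P *ᵥ e)‖ := norm_add_le _ _
      _ ≤ ‖f‖ + γ * ‖e‖ := by
        rw [norm_smul, Real.norm_of_nonneg hγ0]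
        gcongr
        exact norm_mulVec_le_of_stochastic h0 h1 e
  rw [le_div_iff₀ (by linarith)]
  linarith

/-- The resolvent of a stochastic matrix. -/
theorem exists_resolvent {P : Matrix S S ℝ} (h0 : ∀ i j, 0 ≤ P i j)
    (h1 : ∀ i, ∑ j, P i j = 1) {γ : ℝ} (hγ0 : 0 ≤ γ) (hγ1 : γ < 1) :
    ∃ R : (S → ℝ) →ₗ[ℝ] (S → ℝ), ∀ v, R v = v + γ • (P *ᵥ (R v)) := by
  let T : (S → ℝ) →ₗ[ℝ] (S → ℝ) := LinearMap.id - γ • P.mulVecLin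
  have hT : ∀ v, T v = v - γ • (P *ᵥ v) := fun v => rfl
  have hinj : Function.Injective T := by
    rw [← LinearMap.ker_eq_bot, LinearMap.ker_eq_bot']
    intro v hv
    have h := norm_le_of_eq_add_smul_mulVec h0 h1 hγ0 hγ1 (e := v) (f := 0) (by
      rw [zero_add]; exact sub_eq_zero.1 hv)
    simpa using h
  refine ⟨(LinearEquiv.ofInjectiveEndo T hinj).symm.toLinearMap, fun v => ?_⟩
  have : T ((LinearEquiv.ofInjectiveEndo T hinj).symm v) = v :=
    LinearEquiv.apply_symm_apply (LinearEquiv.ofInjectiveEndo T hinj) v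
  rw [hT, sub_eq_iff_eq_add] at this
  exact this

variable {P P' : Matrix S S ℝ} {b b' W W' : S → ℝ} {γ kb kp B : ℝ}

/-- The difference `W' - W` solves the Bellman equation of `P` with source `(b' - b) + γ(P' - P)W'`.
-/
theorem norm_bellman_sub_le (h0 : ∀ i j, 0 ≤ P i j) (h1 : ∀ i, ∑ j, P i j = 1) (hγ0 : 0 ≤ γ)
    (hγ1 : γ < 1) (hW : W = b + γ • (P *ᵥ W)) (hW' : W' = b' + γ • (P' *ᵥ W'))
    (hb : ‖b' - b‖ ≤ kb) (hkp : 0 ≤ kp) (hp : ∀ i j, |P' i j - P i j| ≤ kp) (hB : ‖W'‖ ≤ B) :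
    ‖W' - W‖ ≤ (kb + γ * (Fintype.card S * kp * B)) / (1 - γ) := by
  have h := norm_le_of_eq_add_smul_mulVec h0 h1 hγ0 hγ1 (e := W' - W)
    (f := (b' - b) + γ • ((P' - P) *ᵥ W')) (by
      rw [sub_mulVec, mulVec_sub]
      nth_rw 1 [hW, hW']
      module)
  refine h.trans (div_le_div_of_nonneg_right ?_ (by linarith))
  refine (norm_add_le _ _).trans (add_le_add hb ?_)
  rw [norm_smul, Real.norm_of_nonneg hγ0]
  refine mul_le_mul_of_nonneg_left ?_ hγ0
  exact (norm_mulVec_le_card hkp hp W').trans (by gcongr)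

/-- `D` is the derivative of the solution, obtained by differentiating the Bellman equation. The
remainder `W' - W - D` solves the same equation, its source being the remainders of `b` and `P` plus
the cross term `γ(P' - P)(W' - W)`, a product of two first-order quantities. -/
theorem norm_bellman_sub_sub_le {dP : Matrix S S ℝ} {db D : S → ℝ} {qb qp k : ℝ}
    (h0 : ∀ i j, 0 ≤ P i j) (h1 : ∀ i, ∑ j, P i j = 1) (hγ0 : 0 ≤ γ)
    (hγ1 : γ < 1) (hW : W = b + γ • (P *ᵥ W)) (hW' : W' = b' + γ • (P' *ᵥ W'))
    (hD : D = (db + γ • (dP *ᵥ W)) + γ • (P *ᵥ D))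
    (hb : ‖b' - b - db‖ ≤ qb) (hkp : 0 ≤ kp) (hp : ∀ i j, |P' i j - P i j| ≤ kp)
    (hqp : 0 ≤ qp) (hdp : ∀ i j, |P' i j - P i j - dP i j| ≤ qp) (hB : ‖W‖ ≤ B)
    (hk : ‖W' - W‖ ≤ k) :
    ‖W' - W - D‖ ≤
      (qb + γ * (Fintype.card S * qp * B) + γ * (Fintype.card S * kp * k)) / (1 - γ) := by
  have h := norm_le_of_eq_add_smul_mulVec h0 h1 hγ0 hγ1 (e := W' - W - D)
    (f := (b' - b - db) + γ • ((P' - P - dP) *ᵥ W) + γ • ((P' - P) *ᵥ (W' - W))) (by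
      simp only [sub_mulVec, mulVec_sub]
      nth_rw 1 [hW, hW', hD]
      module)
  refine h.trans (div_le_div_of_nonneg_right ?_ (by linarith))
  refine (norm_add₃_le).trans (add_le_add (add_le_add hb ?_) ?_)
  · rw [norm_smul, Real.norm_of_nonneg hγ0]
    refine mul_le_mul_of_nonneg_left ?_ hγ0
    exact (norm_mulVec_le_card hqp hdp W).trans (by gcongr)
  · rw [norm_smul, Real.norm_of_nonneg hγ0]
    refine mul_le_mul_of_nonneg_left ?_ hγ0
    exact (norm_mulVec_le_card hkp hp _).trans (by gcongr)

end Resolvent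

/-! ### Entropy away from zero -/

section NegMulLog

/-- The tangent-line inequality of the concave function `-x log x`, got from `log (x/y) ≤ x/y - 1`.
-/
theorem negMulLog_sub_le {x y : ℝ} (hx : 0 < x) (hy : 0 < y) :
    y.negMulLog - x.negMulLog ≤ -(1 + Real.log x) * (y - x) := by
  have h := Real.log_le_sub_one_of_pos (div_pos hx hy)
  rw [Real.log_div hx.ne' hy.ne'] at h
  have h2 := mul_le_mul_of_nonneg_left h hy.le
  have h3 : y * (x / y - 1) = x - y := by field_simp
  rw [h3] at h2
  simp only [Real.negMulLog]
  linarith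

/-- Concavity fixes the sign of the remainder; the other side is `log (y/x) ≤ y/x - 1`, which gives
`(y-x)²/x`. -/
theorem abs_negMulLog_sub_sub_le {m x y : ℝ} (hm : 0 < m) (hx : m ≤ x) (hy : m ≤ y) :
    |y.negMulLog - x.negMulLog - -(1 + Real.log x) * (y - x)| ≤ (y - x) ^ 2 / m := by
  have hx0 : 0 < x := hm.trans_le hx
  have hy0 : 0 < y := hm.trans_le hy
  have h1 := negMulLog_sub_le hx0 hy0
  rw [abs_of_nonpos (by linarith)]
  have h := Real.log_le_sub_one_of_pos (div_pos hy0 hx0)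
  rw [Real.log_div hy0.ne' hx0.ne'] at h
  have h2 := mul_le_mul_of_nonneg_left h hy0.le
  have h3 : y * (y / x - 1) = (y - x) ^ 2 / x + (y - x) := by field_simp; ring
  have h4 : (y - x) ^ 2 / x ≤ (y - x) ^ 2 / m := by gcongr
  simp only [Real.negMulLog]
  nlinarith

theorem abs_one_add_log_le {m x : ℝ} (hm : 0 < m) (hx : m ≤ x) (hx1 : x ≤ 1) :
    |1 + Real.log x| ≤ 1 / m := by
  have hx0 : 0 < x := hm.trans_le hx
  have h1 := Real.log_nonpos hx0.le hx1
  have h2 := Real.one_sub_inv_le_log_of_pos hx0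
  have h3 : x⁻¹ ≤ m⁻¹ := inv_anti₀ hm hx
  have h4 : 1 ≤ m⁻¹ := (one_le_inv₀ hm).2 (hx.trans hx1)
  rw [one_div, abs_le]
  constructor <;> linarith

theorem abs_negMulLog_sub_le {m x y : ℝ} (hm : 0 < m) (hx : m ≤ x) (hy : m ≤ y) (hx1 : x ≤ 1)
    (hy1 : y ≤ 1) : |y.negMulLog - x.negMulLog| ≤ |y - x| / m := by
  have h1 := negMulLog_sub_le (hm.trans_le hx) (hm.trans_le hy)
  have h2 := negMulLog_sub_le (hm.trans_le hy) (hm.trans_le hx)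
  have hb : ∀ c, |1 + Real.log c| ≤ 1 / m → ∀ z, -(1 + Real.log c) * z ≤ |z| / m := by
    intro c hc z
    calc -(1 + Real.log c) * z ≤ |-(1 + Real.log c) * z| := le_abs_self _
      _ = |1 + Real.log c| * |z| := by rw [abs_mul, abs_neg]
      _ ≤ 1 / m * |z| := by gcongr
      _ = |z| / m := by ring
  have h3 := hb x (abs_one_add_log_le hm hx hx1) (y - x)
  have h4 := hb y (abs_one_add_log_le hm hy hy1) (x - y)
  rw [abs_sub_comm x y] at h4
  rw [abs_le]
  constructor <;> linarith

theorem abs_negMulLog_le_one {x : ℝ} (hx : 0 < x) (hx1 : x ≤ 1) : |x.negMulLog| ≤ 1 := by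
  rw [abs_of_nonneg (Real.negMulLog_nonneg hx.le hx1)]
  have h2 := mul_le_mul_of_nonneg_left (Real.one_sub_inv_le_log_of_pos hx) hx.le
  have h3 : x * (1 - x⁻¹) = x - 1 := by field_simp
  simp only [Real.negMulLog]
  linarith

end NegMulLog

/-! ### First-order expansion on a convex set -/

section Policies

theorem convex_policySet {S A : Type*} [Fintype A] : Convex ℝ (policySet S A) := by
  intro π hπ π' hπ' a b ha hb hab
  refine ⟨fun x => ?_, fun s => ?_⟩
  · have h := convex_Icc (0 : ℝ) 1 (hπ.1 x) (hπ'.1 x) ha hb hab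
    simpa using h
  · simp only [PiLp.add_apply, PiLp.smul_apply, smul_eq_mul, Finset.sum_add_distrib,
      ← Finset.mul_sum]
    rw [hπ.2, hπ'.2, mul_one, mul_one, hab]

variable {S A : Type*} [Fintype S] [Fintype A]

/-- Mean value inequality on the segment from `π` to `π'`, where the gradient moves by at most `c‖π'
- π‖`. The sharper factor `1/2` is not needed. -/
theorem abs_sub_sub_inner_le {f : PolicyVec S A → ℝ} {G : PolicyVec S A → PolicyVec S A} {c : ℝ}
    (hc : 0 ≤ c) {s : Set (PolicyVec S A)} (hs : Convex ℝ s)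
    (hf : ∀ π ∈ s, HasGradientWithinAt f (G π) s π)
    (hG : ∀ π ∈ s, ∀ π' ∈ s, ‖G π' - G π‖ ≤ c * ‖π' - π‖)
    {π π' : PolicyVec S A} (hπ : π ∈ s) (hπ' : π' ∈ s) :
    |f π' - f π - inner ℝ (G π) (π' - π)| ≤ c * ‖π' - π‖ ^ 2 := by
  have hseg : segment ℝ π π' ⊆ s := hs.segment_subset hπ hπ'
  have h := (convex_segment π π').norm_image_sub_le_of_norm_hasFDerivWithin_le'
    (f := f) (f' := fun z => InnerProductSpace.toDual ℝ _ (G z))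
    (φ := InnerProductSpace.toDual ℝ _ (G π)) (C := c * ‖π' - π‖)
    (fun z hz => (hf z (hseg hz)).hasFDerivWithinAt.mono hseg)
    (fun z hz => by
      rw [← map_sub, LinearIsometryEquiv.norm_map]
      refine (hG π hπ z (hseg hz)).trans (mul_le_mul_of_nonneg_left ?_ hc)
      obtain ⟨a, b, ha, hb, hab, rfl⟩ := hz
      have : a • π + b • π' - π = b • (π' - π) := by
        rw [← eq_sub_iff_add_eq] at hab
        rw [hab]; module
      rw [this, norm_smul, Real.norm_of_nonneg hb]
      exact mul_le_of_le_one_left (norm_nonneg _) (by linarith))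
    (left_mem_segment ℝ π π') (right_mem_segment ℝ π π')
  rw [Real.norm_eq_abs, InnerProductSpace.toDual_apply_apply] at h
  rw [pow_two, ← mul_assoc]
  exact h

theorem abs_apply_le_norm {ι : Type*} [Fintype ι] (v : EuclideanSpace ℝ ι) (x : ι) :
    |v x| ≤ ‖v‖ := PiLp.norm_apply_le v x

end Policies

end PerfRL

namespace PerfRL

/-! ### State-level reward and kernel, and their expansions -/

section Value

open Matrix

variable {S A : Type*} [Fintype S] [Fintype A]

namespace PerformativeMDP

variable (M : PerformativeMDP S A)

/-- The transition matrix of the state chain. -/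
noncomputable def stateKernel (π : PolicyVec S A) : Matrix S S ℝ :=
  Matrix.of fun s s' => ∑ a, π (s, a) * M.p π (s, a, s')

/-- The expected entropy-regularized reward in each state. -/
noncomputable def stateReward (lam : ℝ) (π : PolicyVec S A) : S → ℝ :=
  fun s => ∑ a, (π (s, a) * M.r π (s, a) + lam * (π (s, a)).negMulLog)

variable {M}

theorem stateKernel_nonneg {π : PolicyVec S A} (hπ : π ∈ policySet S A) (s s' : S) :
    0 ≤ M.stateKernel π s s' :=
  Finset.sum_nonneg fun _ _ => mul_nonneg (hπ.1 _).1 ((M.p_mem π hπ).1 _).1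

theorem sum_stateKernel {π : PolicyVec S A} (hπ : π ∈ policySet S A) (s : S) :
    ∑ s', M.stateKernel π s s' = 1 := by
  simp only [stateKernel, Matrix.of_apply]
  rw [Finset.sum_comm]
  simp only [← Finset.mul_sum, (M.p_mem π hπ).2, mul_one, hπ.2]

theorem perfValue_eq [MeasurableSpace S] [MeasurableSpace A]
    [MeasurableSingletonClass S] [MeasurableSingletonClass A] {γ lam : ℝ} (hγ0 : 0 ≤ γ)
    (hγ1 : γ < 1) {π : PolicyVec S A} (hπ : π ∈ policySet S A) {W : S → ℝ}
    (hW : W = M.stateReward lam π + γ • (M.stateKernel π *ᵥ W)) :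
    M.perfValue γ lam π = ∑ s, M.ρ s * W s := by
  -- The state-action value function: its average over actions is `W`, so it solves the Bellman
  -- equation on pairs. Where `π x = 0` the convention for `Real.log 0` is harmless, the weight
  -- being zero.
  let Z : S × A → ℝ := fun x => M.r π x - lam * Real.log (π x)
      + γ * ∑ s', M.p π (x.1, x.2, s') * W s'
  have hZW : ∀ s, ∑ a, π (s, a) * Z (s, a) = W s := by
    intro s
    have h := congrFun hW s
    simp only [Pi.add_apply, Pi.smul_apply, smul_eq_mul, mulVec, dotProduct, stateKernel,
      Matrix.of_apply, stateReward] at h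
    rw [h]
    simp only [Finset.sum_mul]
    rw [Finset.sum_comm, Finset.mul_sum, ← Finset.sum_add_distrib]
    refine Finset.sum_congr rfl fun a _ => ?_
    simp only [Z, Real.negMulLog, mul_assoc]
    rw [← Finset.mul_sum]
    ring
  rw [perfValue, dif_pos hπ, value, regValue_eq_of_bellman hγ0 hγ1 _ _ _ _ Z]
  · rw [Fintype.sum_prod_type]
    simp only [mul_assoc, ← Finset.mul_sum, hZW]
  · intro x
    rw [Fintype.sum_prod_type]
    simp only [mul_assoc, ← Finset.mul_sum, hZW]
    rfl

section Expansion

variable {εp εr Sp Sr lam m : ℝ} {π π' : PolicyVec S A}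

theorem abs_sum_card_le {f : A → ℝ} {c : ℝ} (h : ∀ a, |f a| ≤ c) :
    |∑ a, f a| ≤ Fintype.card A * c := by
  refine (Finset.abs_sum_le_sum_abs _ _).trans ((Finset.sum_le_sum fun a _ => h a).trans ?_)
  rw [Finset.sum_const, Finset.card_univ, nsmul_eq_mul]

theorem abs_mul_sub_mul_le {x y f g k e : ℝ} (hx0 : 0 ≤ x) (hx1 : x ≤ 1) (hg : |g| ≤ 1)
    (hxy : |y - x| ≤ k) (hfg : |g - f| ≤ e * k) :
    |y * g - x * f| ≤ (1 + e) * k := by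
  have : y * g - x * f = (y - x) * g + x * (g - f) := by ring
  rw [this]
  refine (abs_add_le _ _).trans ?_
  rw [abs_mul, abs_mul, abs_of_nonneg hx0]
  have h1 := mul_le_mul hxy hg (abs_nonneg _) ((abs_nonneg _).trans hxy)
  have h2 := mul_le_mul hx1 hfg (abs_nonneg _) zero_le_one
  linarith

/-- Product rule with remainder: `c` accounts for the linearization error of the second factor, `e`
for the cross term `(y - x)(g - f)`. -/
theorem abs_mul_sub_mul_sub_le {x y f g d k e c : ℝ} (hx0 : 0 ≤ x) (hx1 : x ≤ 1)
    (hxy : |y - x| ≤ k) (hfg : |g - f| ≤ e * k) (hd : |g - f - d| ≤ c * k ^ 2) :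
    |y * g - x * f - ((y - x) * f + x * d)| ≤ (c + e) * k ^ 2 := by
  have : y * g - x * f - ((y - x) * f + x * d) = x * (g - f - d) + (y - x) * (g - f) := by ring
  rw [this]
  refine (abs_add_le _ _).trans ?_
  rw [abs_mul, abs_mul, abs_of_nonneg hx0]
  have h1 := mul_le_mul hx1 hd (abs_nonneg _) zero_le_one
  have h2 := mul_le_mul hxy hfg (abs_nonneg _) ((abs_nonneg _).trans hxy)
  nlinarith

theorem abs_stateKernel_sub_le (hM : M.Sensitive εp εr) (hπ : π ∈ policySet S A)
    (hπ' : π' ∈ policySet S A) (s s' : S) :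
    |M.stateKernel π' s s' - M.stateKernel π s s'| ≤
      Fintype.card A * ((1 + εp) * ‖π' - π‖) := by
  simp only [stateKernel, Matrix.of_apply]
  rw [← Finset.sum_sub_distrib]
  refine abs_sum_card_le fun a => ?_
  have hp := (M.p_mem π' hπ').1 (s, a, s')
  refine abs_mul_sub_mul_le (hπ.1 _).1 (hπ.1 _).2 (abs_le.2 ⟨by linarith [hp.1], hp.2⟩) ?_ ?_
  · exact abs_apply_le_norm (π' - π) _
  · exact (abs_apply_le_norm (M.p π' - M.p π) _).trans (hM π hπ π' hπ').1

theorem norm_stateReward_le (hlam : 0 ≤ lam) (hm : 0 < m) (hπ : π ∈ policySubset S A m) :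
    ‖M.stateReward lam π‖ ≤ Fintype.card A * (1 + lam) := by
  rw [pi_norm_le_iff_of_nonneg (by positivity)]
  refine fun s => abs_sum_card_le fun a => ?_
  have hx := hπ.1.1 (s, a)
  have hr := (M.r_mem π hπ.1) (s, a)
  have h1 := abs_negMulLog_le_one (hm.trans_le (hπ.2 (s, a))) hx.2
  refine (abs_add_le _ _).trans ?_
  rw [abs_mul, abs_mul, abs_of_nonneg hlam, abs_of_nonneg hx.1, abs_of_nonneg hr.1]
  exact add_le_add (mul_le_one₀ hx.2 hr.1 hr.2) (mul_le_of_le_one_right hlam h1)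

theorem norm_stateReward_sub_le (hM : M.Sensitive εp εr) (hlam : 0 ≤ lam) (hεr : 0 ≤ εr)
    (hm : 0 < m) (hm1 : m ≤ 1) (hπ : π ∈ policySubset S A m) (hπ' : π' ∈ policySubset S A m) :
    ‖M.stateReward lam π' - M.stateReward lam π‖ ≤
      Fintype.card A * ((1 + εr + lam) / m * ‖π' - π‖) := by
  rw [pi_norm_le_iff_of_nonneg (by positivity)]
  intro s
  rw [Pi.sub_apply, stateReward, stateReward, ← Finset.sum_sub_distrib]
  refine abs_sum_card_le fun a => ?_
  have hr := (M.r_mem π' hπ'.1) (s, a)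
  have hxy : |π' (s, a) - π (s, a)| ≤ ‖π' - π‖ := abs_apply_le_norm (π' - π) _
  have h1 := abs_mul_sub_mul_le (hπ.1.1 (s, a)).1 (hπ.1.1 (s, a)).2
    (abs_le.2 ⟨by linarith [hr.1], hr.2⟩) hxy
    ((abs_apply_le_norm (M.r π' - M.r π) (s, a)).trans (hM π hπ.1 π' hπ'.1).2)
  have h2 := abs_negMulLog_sub_le hm (hπ.2 (s, a)) (hπ'.2 (s, a)) (hπ.1.1 (s, a)).2
    (hπ'.1.1 (s, a)).2
  have h3 : (π' (s, a) * M.r π' (s, a) + lam * (π' (s, a)).negMulLog)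
      - (π (s, a) * M.r π (s, a) + lam * (π (s, a)).negMulLog)
      = (π' (s, a) * M.r π' (s, a) - π (s, a) * M.r π (s, a))
        + lam * ((π' (s, a)).negMulLog - (π (s, a)).negMulLog) := by ring
  rw [h3]
  refine (abs_add_le _ _).trans ?_
  rw [abs_mul lam, abs_of_nonneg hlam]
  calc _ ≤ (1 + εr) * ‖π' - π‖ + lam * (‖π' - π‖ / m) :=
        add_le_add h1 (mul_le_mul_of_nonneg_left (h2.trans (by gcongr)) hlam)
    _ ≤ (1 + εr) * ‖π' - π‖ / m + lam * (‖π' - π‖ / m) := by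
        gcongr
        exact le_div_self (by positivity) hm hm1
    _ = (1 + εr + lam) / m * ‖π' - π‖ := by ring

theorem exists_stateKernel_expansion (hM : M.Sensitive εp εr) (hS : M.Smooth Sp Sr)
    (hSp : 0 ≤ Sp) (hπ : π ∈ policySet S A) :
    ∃ g : S → S → PolicyVec S A, ∀ π' ∈ policySet S A, ∀ s s',
      |M.stateKernel π' s s' - M.stateKernel π s s' - inner ℝ (g s s') (π' - π)| ≤
        Fintype.card A * ((Sp + εp) * ‖π' - π‖ ^ 2) := by
  classical
  choose G hG hG' using hS.1
  -- The product-rule gradient of `∑ a, π(s,a) p(s,a,s')`.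
  refine ⟨fun s s' => ∑ a, (M.p π (s, a, s') • EuclideanSpace.single (s, a) 1
    + π (s, a) • G (s, a, s') π), fun π' hπ' s s' => ?_⟩
  simp only [stateKernel, Matrix.of_apply]
  rw [sum_inner, ← Finset.sum_sub_distrib, ← Finset.sum_sub_distrib]
  refine abs_sum_card_le fun a => ?_
  have h := abs_mul_sub_mul_sub_le (hπ.1 (s, a)).1 (hπ.1 (s, a)).2
    (abs_apply_le_norm (π' - π) (s, a))
    ((abs_apply_le_norm (M.p π' - M.p π) (s, a, s')).trans (hM π hπ π' hπ').1)
    (abs_sub_sub_inner_le hSp convex_policySet (hG (s, a, s')) (hG' (s, a, s')) hπ hπ')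
  have h4 : inner ℝ (M.p π (s, a, s') • EuclideanSpace.single (s, a) (1 : ℝ)) (π' - π)
      = (π' (s, a) - π (s, a)) * M.p π (s, a, s') := by
    rw [real_inner_smul_left, EuclideanSpace.inner_single_left]
    simp [mul_comm]
  rw [inner_add_left, h4, real_inner_smul_left]
  exact h

theorem exists_stateReward_expansion (hM : M.Sensitive εp εr) (hS : M.Smooth Sp Sr)
    (hSr : 0 ≤ Sr) (hεr : 0 ≤ εr) (hlam : 0 ≤ lam) (hm : 0 < m) (hm1 : m ≤ 1)
    (hπ : π ∈ policySubset S A m) :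
    ∃ g : S → PolicyVec S A, ∀ π' ∈ policySubset S A m, ∀ s,
      |M.stateReward lam π' s - M.stateReward lam π s - inner ℝ (g s) (π' - π)| ≤
        Fintype.card A * ((Sr + εr + lam) / m * ‖π' - π‖ ^ 2) := by
  classical
  choose G hG hG' using hS.2
  refine ⟨fun s => ∑ a, (M.r π (s, a) • EuclideanSpace.single (s, a) 1
    + π (s, a) • G (s, a) π
    + (lam * -(1 + Real.log (π (s, a)))) • EuclideanSpace.single (s, a) 1),
    fun π' hπ' s => ?_⟩
  simp only [stateReward]
  rw [sum_inner, ← Finset.sum_sub_distrib, ← Finset.sum_sub_distrib]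
  refine abs_sum_card_le fun a => ?_
  have hxy : |π' (s, a) - π (s, a)| ≤ ‖π' - π‖ := abs_apply_le_norm (π' - π) _
  have h1 := abs_mul_sub_mul_sub_le (hπ.1.1 (s, a)).1 (hπ.1.1 (s, a)).2 hxy
    ((abs_apply_le_norm (M.r π' - M.r π) (s, a)).trans (hM π hπ.1 π' hπ'.1).2)
    (abs_sub_sub_inner_le hSr convex_policySet (hG (s, a)) (hG' (s, a)) hπ.1 hπ'.1)
  have h2 := abs_negMulLog_sub_sub_le hm (hπ.2 (s, a)) (hπ'.2 (s, a))
  have h3 : (π' (s, a) - π (s, a)) ^ 2 ≤ ‖π' - π‖ ^ 2 := by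
    rw [← sq_abs]; gcongr
  have h4 : ∀ c : ℝ, inner ℝ (c • EuclideanSpace.single (s, a) (1 : ℝ)) (π' - π)
      = c * (π' (s, a) - π (s, a)) := by
    intro c
    rw [real_inner_smul_left, EuclideanSpace.inner_single_left]
    simp
  rw [inner_add_left, inner_add_left, h4, h4, real_inner_smul_left]
  have h5 : ∀ x y f g z w i : ℝ, (y * g + lam * w) - (x * f + lam * z)
      - (f * (y - x) + x * i + lam * -(1 + Real.log x) * (y - x))
      = (y * g - x * f - ((y - x) * f + x * i))
        + lam * (w - z - -(1 + Real.log x) * (y - x)) := by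
    intros; ring
  rw [h5]
  refine (abs_add_le _ _).trans ?_
  rw [abs_mul lam, abs_of_nonneg hlam]
  calc _ ≤ (Sr + εr) * ‖π' - π‖ ^ 2 + lam * (‖π' - π‖ ^ 2 / m) :=
        add_le_add h1 (mul_le_mul_of_nonneg_left (h2.trans (by gcongr)) hlam)
    _ ≤ (Sr + εr) * ‖π' - π‖ ^ 2 / m + lam * (‖π' - π‖ ^ 2 / m) := by
        gcongr
        exact le_div_self (by positivity) hm hm1
    _ = (Sr + εr + lam) / m * ‖π' - π‖ ^ 2 := by ring

end Expansion

end PerformativeMDP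

end Value

end PerfRL

namespace PerfRL

/-! ### Lipschitz bound and linearization of the value -/

section Expansion

open Matrix

variable {S A : Type*} [Fintype S] [Fintype A]

theorem abs_sum_mul_le_norm {ρ : EuclideanSpace ℝ S} (hρ : ρ ∈ stateDistSet S) (v : S → ℝ) :
    |∑ s, ρ s * v s| ≤ ‖v‖ := by
  calc |∑ s, ρ s * v s| ≤ ∑ s, |ρ s * v s| := Finset.abs_sum_le_sum_abs _ _
    _ ≤ ∑ s, ρ s * ‖v‖ := by
        refine Finset.sum_le_sum fun s _ => ?_
        rw [abs_mul, abs_of_nonneg (hρ.1 s).1]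
        exact mul_le_mul_of_nonneg_left (norm_le_pi_norm v s) (hρ.1 s).1
    _ = ‖v‖ := by rw [← Finset.sum_mul, hρ.2, one_mul]

theorem PerformativeMDP.nonempty_index (M : PerformativeMDP S A) {π : PolicyVec S A}
    (hπ : π ∈ policySet S A) : Nonempty (S × A) := by
  have hS : Nonempty S := by
    by_contra h
    rw [not_nonempty_iff] at h
    have := M.ρ_mem.2
    simp at this
  have hA : Nonempty A := by
    by_contra h
    rw [not_nonempty_iff] at h
    have := hπ.2 hS.some
    simp at this
  infer_instance

variable [MeasurableSpace S] [MeasurableSpace A]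
    [MeasurableSingletonClass S] [MeasurableSingletonClass A]

/-- The performative value function is Lipschitz and has a first-order expansion with quadratic
remainder on the policies that are bounded away from zero. -/
theorem exists_perfValue_expansion {γ lam εp εr Sp Sr : ℝ} (hγ0 : 0 < γ) (hγ1 : γ < 1)
    (hlam : 0 ≤ lam) (hεp : 0 ≤ εp) (hεr : 0 ≤ εr) (hSp : 0 ≤ Sp) (hSr : 0 ≤ Sr) :
    ∃ K > 0, ∃ Q > 0, ∀ M : PerformativeMDP S A, M.Sensitive εp εr → M.Smooth Sp Sr →
      ∀ m : ℝ, 0 < m → ∀ π ∈ policySubset S A m, ∃ g, ∀ π' ∈ policySubset S A m,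
        |M.perfValue γ lam π' - M.perfValue γ lam π| ≤ K / m * ‖π' - π‖ ∧
        |M.perfValue γ lam π' - M.perfValue γ lam π - inner ℝ g (π' - π)| ≤
          Q / m * ‖π' - π‖ ^ 2 := by
  set nA : ℝ := (Fintype.card A : ℝ)
  set nS : ℝ := (Fintype.card S : ℝ)
  have hnA : 0 ≤ nA := Nat.cast_nonneg _
  have hnS : 0 ≤ nS := Nat.cast_nonneg _
  have hγ' : 0 < 1 - γ := by linarith
  set B : ℝ := nA * (1 + lam) / (1 - γ) with hB
  have hB0 : 0 ≤ B := by positivity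
  set K₀ : ℝ := (nA * (1 + εr + lam) + γ * (nS * (nA * (1 + εp)) * B)) / (1 - γ) with hK₀
  have hK₀0 : 0 ≤ K₀ := by positivity
  set Q₀ : ℝ := (nA * (Sr + εr + lam) + γ * (nS * (nA * (Sp + εp)) * B)
    + γ * (nS * (nA * (1 + εp)) * K₀)) / (1 - γ) with hQ₀
  have hQ₀0 : 0 ≤ Q₀ := by positivity
  -- The constants are fixed before any process is given, so `S` or `A` may be empty and `K₀`, `Q₀`
  -- may vanish; adding 1 keeps them positive.
  refine ⟨K₀ + 1, by positivity, Q₀ + 1, by positivity, fun M hM hS m hm π hπ => ?_⟩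
  -- This lets terms without entropy be divided by `m` too, so that a single factor `1/m` comes out.
  have hm1 : m ≤ 1 := by
    obtain ⟨x⟩ := M.nonempty_index hπ.1
    exact (hπ.2 x).trans (hπ.1.1 x).2
  have hsol : ∀ π ∈ policySubset S A m, ∃ W : S → ℝ,
      W = M.stateReward lam π + γ • (M.stateKernel π *ᵥ W) ∧ ‖W‖ ≤ B := by
    intro π hπ
    have h0 := PerformativeMDP.stateKernel_nonneg (M := M) hπ.1
    have h1 := PerformativeMDP.sum_stateKernel (M := M) hπ.1
    obtain ⟨R, hR⟩ := exists_resolvent h0 h1 hγ0.le hγ1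
    refine ⟨R (M.stateReward lam π), hR _, ?_⟩
    refine (norm_le_of_eq_add_smul_mulVec h0 h1 hγ0.le hγ1 (hR _)).trans ?_
    exact div_le_div_of_nonneg_right (PerformativeMDP.norm_stateReward_le hlam hm hπ) hγ'.le
  have h0 := PerformativeMDP.stateKernel_nonneg (M := M) hπ.1
  have h1 := PerformativeMDP.sum_stateKernel (M := M) hπ.1
  obtain ⟨R, hR⟩ := exists_resolvent h0 h1 hγ0.le hγ1
  obtain ⟨W, hW, hWB⟩ := hsol π hπ
  obtain ⟨gp, hgp⟩ := PerformativeMDP.exists_stateKernel_expansion hM hS hSp hπ.1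
  obtain ⟨gr, hgr⟩ :=
    PerformativeMDP.exists_stateReward_expansion hM hS hSr hεr hlam hm hm1 hπ
  let dP : PolicyVec S A → Matrix S S ℝ := fun h => Matrix.of fun s s' => inner ℝ (gp s s') h
  let db : PolicyVec S A → S → ℝ := fun h s => inner ℝ (gr s) h
  -- Derivative of the source `b + γPW` with `W` frozen. The derivative of the value is `ev ∘ R ∘
  -- F`, with `R` the resolvent, and the gradient is its Riesz representative.
  let F : PolicyVec S A →ₗ[ℝ] (S → ℝ) :=
    { toFun := fun h => db h + γ • (dP h *ᵥ W)
      map_add' := by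
        intro h h'
        ext s
        simp only [db, dP, inner_add_right, mulVec, dotProduct, Pi.add_apply, Pi.smul_apply,
          Matrix.of_apply, add_mul, Finset.sum_add_distrib, smul_eq_mul, mul_add]
        ring
      map_smul' := by
        intro c h
        ext s
        simp only [db, dP, real_inner_smul_right, mulVec, dotProduct, Pi.add_apply,
          Pi.smul_apply, Matrix.of_apply, smul_eq_mul, RingHom.id_apply, mul_assoc,
          ← Finset.mul_sum]
        ring }
  let ev : (S → ℝ) →ₗ[ℝ] ℝ :=
    { toFun := fun v => ∑ s, M.ρ s * v s
      map_add' := by intro v w; simp [mul_add, Finset.sum_add_distrib]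
      map_smul' := by
        intro c v
        simp only [Pi.smul_apply, smul_eq_mul, RingHom.id_apply, Finset.mul_sum]
        exact Finset.sum_congr rfl fun s _ => by ring }
  refine ⟨(InnerProductSpace.toDual ℝ (PolicyVec S A)).symm
    (LinearMap.toContinuousLinearMap (ev ∘ₗ R ∘ₗ F)), fun π' hπ' => ?_⟩
  obtain ⟨W', hW', hWB'⟩ := hsol π' hπ'
  rw [InnerProductSpace.toDual_symm_apply, PerformativeMDP.perfValue_eq hγ0.le hγ1 hπ.1 hW,
    PerformativeMDP.perfValue_eq hγ0.le hγ1 hπ'.1 hW']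
  set k : ℝ := ‖π' - π‖ with hk
  have hk0 : 0 ≤ k := norm_nonneg _
  have hLip : ‖W' - W‖ ≤ K₀ / m * k := by
    refine (norm_bellman_sub_le h0 h1 hγ0.le hγ1 hW hW'
      (PerformativeMDP.norm_stateReward_sub_le hM hlam hεr hm hm1 hπ hπ') (by positivity)
      (PerformativeMDP.abs_stateKernel_sub_le hM hπ.1 hπ'.1) hWB').trans ?_
    rw [← hk]
    change (nA * ((1 + εr + lam) / m * k) + γ * (nS * (nA * ((1 + εp) * k)) * B)) / (1 - γ) ≤ _
    calc (nA * ((1 + εr + lam) / m * k) + γ * (nS * (nA * ((1 + εp) * k)) * B)) / (1 - γ)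
        ≤ (nA * ((1 + εr + lam) / m * k) + (γ * (nS * (nA * ((1 + εp) * k)) * B)) / m)
            / (1 - γ) := by
          gcongr
          exact le_div_self (by positivity) hm hm1
      _ = K₀ / m * k := by rw [hK₀]; field_simp
  have hRem : ‖W' - W - R (F (π' - π))‖ ≤ Q₀ / m * k ^ 2 := by
    have h := norm_bellman_sub_sub_le (dP := dP (π' - π)) (db := db (π' - π)) h0 h1 hγ0.le hγ1
      hW hW' (hR (F (π' - π)))
      (qb := nA * ((Sr + εr + lam) / m * k ^ 2))
      (by
        rw [pi_norm_le_iff_of_nonneg (by positivity)]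
        exact fun s => hgr π' hπ' s)
      (by positivity) (PerformativeMDP.abs_stateKernel_sub_le hM hπ.1 hπ'.1)
      (qp := nA * ((Sp + εp) * k ^ 2)) (by positivity)
      (fun s s' => hgp π' hπ'.1 s s') hWB hLip
    refine h.trans ?_
    rw [← hk]
    change (nA * ((Sr + εr + lam) / m * k ^ 2) + γ * (nS * (nA * ((Sp + εp) * k ^ 2)) * B)
      + γ * (nS * (nA * ((1 + εp) * k)) * (K₀ / m * k))) / (1 - γ) ≤ _
    calc _ ≤ (nA * ((Sr + εr + lam) / m * k ^ 2)
          + (γ * (nS * (nA * ((Sp + εp) * k ^ 2)) * B)) / m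
          + γ * (nS * (nA * ((1 + εp) * k)) * (K₀ / m * k))) / (1 - γ) := by
          gcongr
          exact le_div_self (by positivity) hm hm1
      _ = Q₀ / m * k ^ 2 := by rw [hQ₀]; field_simp
  have e1 : ∑ s, M.ρ s * W' s - ∑ s, M.ρ s * W s = ev (W' - W) := (map_sub ev _ _).symm
  have e2 : ev (W' - W) - (LinearMap.toContinuousLinearMap (ev ∘ₗ R ∘ₗ F)) (π' - π)
      = ev (W' - W - R (F (π' - π))) := (map_sub ev _ _).symm
  rw [e1, e2]
  constructor
  · refine (abs_sum_mul_le_norm M.ρ_mem _).trans (hLip.trans ?_)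
    gcongr
    linarith
  · refine (abs_sum_mul_le_norm M.ρ_mem _).trans (hRem.trans ?_)
    gcongr
    linarith

end Expansion

/-! ### Feasible directions and gradients within the policy space -/

section Directions

variable {S A : Type*} [Fintype S] [Fintype A]

theorem add_smul_mem_policySubset {Δ δ : ℝ} (hδ : 0 ≤ δ) (hδΔ : δ ≤ Δ) {π u : PolicyVec S A}
    (hπ : π ∈ policySubset S A Δ) (hu : ‖u‖ ≤ 1) (hu0 : u ∈ zeroRowSum S A) :
    π + δ • u ∈ policySubset S A (Δ - δ) := by
  have hge : ∀ x, Δ - δ ≤ (π + δ • u) x := by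
    intro x
    have h1 := hπ.2 x
    have h2 := abs_le.1 ((abs_apply_le_norm u x).trans hu)
    simp only [PiLp.add_apply, PiLp.smul_apply, smul_eq_mul]
    nlinarith
  have hsum : ∀ s, ∑ a, (π + δ • u) (s, a) = 1 := by
    intro s
    have := hu0 s
    simp only [PiLp.add_apply, PiLp.smul_apply, smul_eq_mul, Finset.sum_add_distrib,
      ← Finset.mul_sum]
    rw [this, hπ.1.2 s, mul_zero, add_zero]
  refine ⟨⟨fun x => ⟨by linarith [hge x], ?_⟩, hsum⟩, hge⟩
  rw [← hsum x.1]
  exact Finset.single_le_sum (f := fun a => (π + δ • u) (x.1, a))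
    (fun a _ => by linarith [hge (x.1, a)]) (Finset.mem_univ x.2)

theorem sub_smul_mem_policySubset {Δ δ : ℝ} (hδ : 0 ≤ δ) (hδΔ : δ ≤ Δ) {π u : PolicyVec S A}
    (hπ : π ∈ policySubset S A Δ) (hu : ‖u‖ ≤ 1) (hu0 : u ∈ zeroRowSum S A) :
    π - δ • u ∈ policySubset S A (Δ - δ) := by
  have := add_smul_mem_policySubset hδ hδΔ hπ (u := -u) (by rwa [norm_neg])
    ((zeroRowSum S A).neg_mem hu0)
  rwa [smul_neg, ← sub_eq_add_neg] at this

theorem hasGradientWithinAt_of_expansion {V : PolicyVec S A → ℝ} {Δ m Q : ℝ} (hmΔ : m < Δ)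
    {π g : PolicyVec S A} (hπ : π ∈ policySubset S A Δ)
    (h : ∀ π' ∈ policySubset S A m, |V π' - V π - inner ℝ g (π' - π)| ≤ Q * ‖π' - π‖ ^ 2) :
    HasGradientWithinAt V g (policySet S A) π := by
  rw [hasGradientWithinAt_iff_hasFDerivWithinAt, hasFDerivWithinAt_iff_isLittleO]
  -- A policy within distance `Δ - m` of `π` has all entries above `m`, so the expansion holds near
  -- `π`.
  have hev : ∀ᶠ π' in nhdsWithin π (policySet S A), π' ∈ policySubset S A m := by
    have hb : Metric.ball π (Δ - m) ∈ nhds π := Metric.ball_mem_nhds _ (by linarith)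
    filter_upwards [self_mem_nhdsWithin, mem_nhdsWithin_of_mem_nhds hb] with π' h1 h2
    refine ⟨h1, fun x => ?_⟩
    rw [Metric.mem_ball, dist_eq_norm] at h2
    have h3 := abs_le.1 (abs_apply_le_norm (π' - π) x)
    have h4 := hπ.2 x
    rw [PiLp.sub_apply] at h3
    linarith
  have hO : (fun π' => V π' - V π - InnerProductSpace.toDual ℝ _ g (π' - π))
      =O[nhdsWithin π (policySet S A)] fun π' => ‖π' - π‖ ^ 2 := by
    refine Asymptotics.IsBigO.of_bound Q ?_
    filter_upwards [hev] with π' hπ'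
    rw [InnerProductSpace.toDual_apply_apply, Real.norm_eq_abs, norm_pow, norm_norm]
    exact h π' hπ'
  refine hO.trans_isLittleO ?_
  have h1 : (fun x : PolicyVec S A => ‖x - π‖) =o[nhds π] fun _ => (1 : ℝ) := by
    rw [Asymptotics.isLittleO_one_iff]
    have : Continuous fun x : PolicyVec S A => ‖x - π‖ := by fun_prop
    simpa using this.tendsto π
  have h2 := (h1.mono (nhdsWithin_le_nhds (s := policySet S A))).mul_isBigO
    (Asymptotics.isBigO_refl (fun x : PolicyVec S A => ‖x - π‖) _)
  simp only [one_mul, ← pow_two] at h2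
  exact h2.of_norm_right

/-- The segment from `π` to `π + Δu` stays in `Π`, so `Δu` is tangent there and derivatives within
`Π` agree on it. Thus all gradients pair equally with `L₀`. -/
theorem inner_eq_of_hasGradientWithinAt {V : PolicyVec S A → ℝ} {Δ : ℝ} (hΔ : 0 < Δ)
    {π g g' : PolicyVec S A} (hπ : π ∈ policySubset S A Δ)
    (hg : HasGradientWithinAt V g (policySet S A) π)
    (hg' : HasGradientWithinAt V g' (policySet S A) π) {u : PolicyVec S A} (hu : ‖u‖ ≤ 1)
    (hu0 : u ∈ zeroRowSum S A) : inner ℝ g u = inner ℝ g' u := by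
  have hmem : Δ • u ∈ tangentConeAt ℝ (policySet S A) π := by
    have h := mem_tangentConeAt_of_segment_subset (convex_policySet.segment_subset hπ.1
      (add_smul_mem_policySubset hΔ.le le_rfl hπ hu hu0).1)
    rwa [add_sub_cancel_left] at h
  have h := hg.hasFDerivWithinAt.unique_on hg'.hasFDerivWithinAt hmem
  rw [InnerProductSpace.toDual_apply_apply, InnerProductSpace.toDual_apply_apply,
    real_inner_smul_right, real_inner_smul_right] at h
  exact mul_left_cancel₀ hΔ.ne' h

end Directions

end PerfRL

namespace PerfRL

/-! ### Second moments of the uniform law on a sphere -/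

section Sphere

open Metric
open scoped Pointwise

variable {E : Type*} [NormedAddCommGroup E] [InnerProductSpace ℝ E] [FiniteDimensional ℝ E]
  [MeasurableSpace E] [BorelSpace E]

/-- The surface measure of the unit sphere is invariant under linear isometries. -/
theorem measurePreserving_toSphere (f : E ≃ₗᵢ[ℝ] E) (φ : sphere (0 : E) 1 → sphere (0 : E) 1)
    (hφ : ∀ u, (φ u : E) = f u) :
    MeasurePreserving φ (volume : Measure E).toSphere (volume : Measure E).toSphere := by
  have hφm : Measurable φ := by
    refine Continuous.measurable (continuous_induced_rng.2 ?_)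
    have : Subtype.val ∘ φ = fun u : sphere (0 : E) 1 => f (u : E) := funext hφ
    rw [this]
    exact f.continuous.comp continuous_subtype_val
  refine ⟨hφm, Measure.ext fun s hs => ?_⟩
  rw [Measure.map_apply hφm hs, Measure.toSphere_apply' _ (hφm hs), Measure.toSphere_apply' _ hs]
  congr 1
  -- Surface measure is, up to a dimensional factor, the volume of the cone over a set; an isometry
  -- carries cones to cones and preserves volume.
  have hpre : Set.Ioo (0 : ℝ) 1 • (((↑) : sphere (0 : E) 1 → E) '' (φ ⁻¹' s))
      = f ⁻¹' (Set.Ioo (0 : ℝ) 1 • (((↑) : sphere (0 : E) 1 → E) '' s)) := by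
    ext x
    simp only [Set.mem_preimage, Set.mem_smul, Set.mem_image, exists_exists_and_eq_and]
    constructor
    · rintro ⟨c, hc, u, hu, rfl⟩
      exact ⟨c, hc, φ u, hu, by rw [hφ, map_smul]⟩
    · rintro ⟨c, hc, v, hv, hx⟩
      have hmem : f.symm (v : E) ∈ sphere (0 : E) 1 := by simp
      have hv' : φ ⟨f.symm v, hmem⟩ = v := Subtype.ext (by rw [hφ]; simp)
      refine ⟨c, hc, ⟨f.symm v, hmem⟩, hv'.symm ▸ hv, ?_⟩
      apply f.injective
      rw [map_smul, ← hx]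
      simp
  rw [hpre]
  exact f.measurePreserving.measure_preimage_emb f.toHomeomorph.measurableEmbedding _

variable (E) in
/-- The normalized surface measure of the unit sphere. -/
noncomputable def uniformSphere : Measure (sphere (0 : E) 1) :=
  ((volume : Measure E).toSphere Set.univ)⁻¹ • (volume : Measure E).toSphere

theorem isProbabilityMeasure_uniformSphere [Nontrivial E] :
    IsProbabilityMeasure (uniformSphere E) := by
  refine ⟨?_⟩
  rw [uniformSphere, Measure.smul_apply, smul_eq_mul]
  refine ENNReal.inv_mul_cancel ?_ (measure_ne_top _ _)
  rw [Ne, Measure.measure_univ_eq_zero]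
  exact Measure.toSphere_ne_zero _

theorem integrable_uniformSphere [Nontrivial E] {f : sphere (0 : E) 1 → ℝ} (hf : Continuous f) :
    Integrable f (uniformSphere E) := by
  have := isProbabilityMeasure_uniformSphere (E := E)
  have := isCompact_sphere (0 : E) 1
  have : CompactSpace (sphere (0 : E) 1) := isCompact_iff_compactSpace.1 this
  obtain ⟨C, hC⟩ := (isCompact_range hf.norm).bddAbove
  exact Integrable.of_bound hf.aestronglyMeasurable C
    (Filter.Eventually.of_forall fun u => hC ⟨u, rfl⟩)

/-- The reflection exchanging `x` and `y` preserves the uniform law. -/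
theorem integral_sq_inner_uniformSphere_congr {x y : E} (h : ‖x‖ = ‖y‖) :
    ∫ u, (inner ℝ x (u : E)) ^ 2 ∂(uniformSphere E)
      = ∫ u, (inner ℝ y (u : E)) ^ 2 ∂(uniformSphere E) := by
  let f : E ≃ₗᵢ[ℝ] E := (ℝ ∙ (x - y))ᗮ.reflection
  have hf : f x = y := Submodule.reflection_sub h
  let φ : sphere (0 : E) 1 → sphere (0 : E) 1 := fun u => ⟨f u, by simp⟩
  have hφ := (measurePreserving_toSphere f φ (fun _ => rfl)).smul_measure
    ((volume : Measure E).toSphere Set.univ)⁻¹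
  have hemb : MeasurableEmbedding φ := by
    have hinv : Function.Involutive φ := fun u =>
      Subtype.ext ((ℝ ∙ (x - y))ᗮ.reflection_reflection u)
    exact (MeasurableEquiv.ofInvolutive φ hinv hφ.measurable).measurableEmbedding
  refine Eq.trans ?_ (hφ.integral_comp hemb fun u => (inner ℝ y (u : E)) ^ 2)
  refine integral_congr_ae (Filter.Eventually.of_forall fun u => ?_)
  change (inner ℝ x (u : E)) ^ 2 = (inner ℝ y (f u)) ^ 2
  rw [← hf]
  rw [f.inner_map_map]

/-- Over an orthonormal basis the squared coordinates sum to 1 and have equal means, so each mean is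
`1/dim`; the rest is scaling. -/
theorem integral_sq_inner_uniformSphere [Nontrivial E] (x : E) :
    ∫ u, (inner ℝ x (u : E)) ^ 2 ∂(uniformSphere E) = ‖x‖ ^ 2 / Module.finrank ℝ E := by
  have := isProbabilityMeasure_uniformSphere (E := E)
  have hd : (Module.finrank ℝ E : ℝ) ≠ 0 := by exact_mod_cast Module.finrank_pos.ne'
  let b := stdOrthonormalBasis ℝ E
  have hsum : ∑ i, ∫ u, (inner ℝ (b i) (u : E)) ^ 2 ∂(uniformSphere E) = 1 := by
    rw [← integral_finsetSum]
    · have : ∀ u : sphere (0 : E) 1, ∑ i, (inner ℝ (b i) (u : E)) ^ 2 = 1 := by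
        intro u
        have h := b.sum_sq_norm_inner_right (u : E)
        simp only [Real.norm_eq_abs, sq_abs, norm_eq_of_mem_sphere, one_pow] at h
        exact h
      simp [this]
    · intro i _
      exact integrable_uniformSphere (by fun_prop)
  obtain ⟨v, hv⟩ := exists_norm_eq E zero_le_one
  have hone : ∫ u, (inner ℝ v (u : E)) ^ 2 ∂(uniformSphere E) = 1 / Module.finrank ℝ E := by
    have h : ∀ i, ∫ u, (inner ℝ (b i) (u : E)) ^ 2 ∂(uniformSphere E)
        = ∫ u, (inner ℝ v (u : E)) ^ 2 ∂(uniformSphere E) := fun i =>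
      integral_sq_inner_uniformSphere_congr (by rw [hv, b.norm_eq_one])
    simp only [h, Finset.sum_const, Finset.card_univ, Fintype.card_fin, nsmul_eq_mul] at hsum
    rw [eq_div_iff hd, mul_comm]
    exact hsum
  have h := integral_sq_inner_uniformSphere_congr (x := x) (y := ‖x‖ • v)
    (by rw [norm_smul, hv, norm_norm, mul_one])
  rw [h]
  simp only [real_inner_smul_left, mul_pow]
  rw [integral_const_mul, hone]
  ring

theorem integral_inner_mul_inner_uniformSphere [Nontrivial E] (x y : E) :
    ∫ u, inner ℝ x (u : E) * inner ℝ y (u : E) ∂(uniformSphere E)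
      = inner ℝ x y / Module.finrank ℝ E := by
  have h : ∀ u : sphere (0 : E) 1, inner ℝ x (u : E) * inner ℝ y (u : E)
      = ((inner ℝ (x + y) (u : E)) ^ 2 - (inner ℝ x (u : E)) ^ 2 - (inner ℝ y (u : E)) ^ 2) / 2 := by
    intro u
    rw [inner_add_left]
    ring
  simp only [h]
  rw [integral_div, integral_sub, integral_sub, integral_sq_inner_uniformSphere,
    integral_sq_inner_uniformSphere, integral_sq_inner_uniformSphere,
    real_inner_eq_norm_add_mul_self_sub_norm_mul_self_sub_norm_mul_self_div_two]
  · ring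
  all_goals exact integrable_uniformSphere (by fun_prop)

end Sphere

/-! ### The uniform direction in `L₀` -/

section UniformDirection

variable {S A : Type*} [Fintype S] [Fintype A]

theorem finrank_zeroRowSum [Nonempty A] :
    (Module.finrank ℝ (zeroRowSum S A) : ℝ) = Fintype.card S * ((Fintype.card A : ℝ) - 1) := by
  classical
  let T : PolicyVec S A →ₗ[ℝ] (S → ℝ) :=
    { toFun := fun u s => ∑ a, u (s, a)
      map_add' := by intro u v; ext s; simp [Finset.sum_add_distrib]
      map_smul' := by intro c u; ext s; simp [Finset.mul_sum] }
  have hker : LinearMap.ker T = zeroRowSum S A := by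
    ext u
    rw [LinearMap.mem_ker]
    exact funext_iff
  have hsurj : Function.Surjective T := by
    intro v
    obtain ⟨a₀⟩ := ‹Nonempty A›
    refine ⟨WithLp.toLp 2 fun x => if x.2 = a₀ then v x.1 else 0, ?_⟩
    ext s
    simp [T]
  have h := LinearMap.finrank_range_add_finrank_ker T
  rw [LinearMap.range_eq_top.2 hsurj, finrank_top, hker, Module.finrank_fintype_fun_eq_card,
    finrank_euclideanSpace, Fintype.card_prod] at h
  have h' : (Fintype.card S : ℝ) + Module.finrank ℝ (zeroRowSum S A)
      = Fintype.card S * Fintype.card A := by exact_mod_cast h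
  linarith

theorem uniformDirection_eq : uniformDirection S A = (uniformSphere (zeroRowSum S A)).map
    (fun u : Metric.sphere (0 : zeroRowSum S A) 1 => ((u : zeroRowSum S A) : PolicyVec S A)) :=
  rfl

theorem measurable_coe_sphere : Measurable
    (fun u : Metric.sphere (0 : zeroRowSum S A) 1 => ((u : zeroRowSum S A) : PolicyVec S A)) :=
  measurable_subtype_coe.comp measurable_subtype_coe

/-- Excludes the degenerate case: the zero measure cannot be the law of a random direction. -/
theorem uniformDirection_eq_zero [Subsingleton (zeroRowSum S A)] : uniformDirection S A = 0 := by
  have h : (volume : Measure (zeroRowSum S A)).toSphere = 0 :=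
    (Measure.toSphere_eq_zero_iff _).2 inferInstance
  rw [uniformDirection_eq, uniformSphere, h, smul_zero, Measure.map_zero]

theorem isProbabilityMeasure_uniformDirection [Nontrivial (zeroRowSum S A)] :
    IsProbabilityMeasure (uniformDirection S A) := by
  have := isProbabilityMeasure_uniformSphere (E := zeroRowSum S A)
  rw [uniformDirection_eq]
  exact Measure.isProbabilityMeasure_map measurable_coe_sphere.aemeasurable

theorem isClosed_unitDirections : IsClosed (unitDirections S A) := by
  have h : unitDirections S A = Metric.sphere 0 1 ∩ (zeroRowSum S A : Set (PolicyVec S A)) := by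
    ext u; simp [unitDirections]
  rw [h]
  exact Metric.isClosed_sphere.inter (zeroRowSum S A).closed_of_finiteDimensional

theorem ae_mem_unitDirections : ∀ᵐ u ∂(uniformDirection S A), u ∈ unitDirections S A := by
  rw [uniformDirection_eq]
  refine (ae_map_iff measurable_coe_sphere.aemeasurable
    (isClosed_unitDirections (S := S) (A := A)).measurableSet).2 ?_
  exact Filter.Eventually.of_forall fun u => ⟨norm_eq_of_mem_sphere u, u.1.2⟩

theorem integral_inner_mul_apply [Nontrivial (zeroRowSum S A)] (g : PolicyVec S A) (x : S × A) :
    ∫ u, inner ℝ g u * u x ∂(uniformDirection S A)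
      = (zeroRowSum S A).starProjection g x / Module.finrank ℝ (zeroRowSum S A) := by
  classical
  have hx : ∀ v : PolicyVec S A, inner ℝ (EuclideanSpace.single x (1 : ℝ)) v = v x := by
    intro v
    rw [EuclideanSpace.inner_single_left]
    simp
  have hm : Measurable fun u : PolicyVec S A => inner ℝ g u * u x := by
    have : Continuous fun u : PolicyVec S A => inner ℝ g u * u x := by fun_prop
    exact this.measurable
  rw [uniformDirection_eq, integral_map measurable_coe_sphere.aemeasurable
    hm.aestronglyMeasurable]
  have h : ∀ u : Metric.sphere (0 : zeroRowSum S A) 1,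
      inner ℝ g ((u : zeroRowSum S A) : PolicyVec S A) * ((u : zeroRowSum S A) : PolicyVec S A) x
      = inner ℝ ((zeroRowSum S A).orthogonalProjectionOnto g) (u : zeroRowSum S A)
        * inner ℝ ((zeroRowSum S A).orthogonalProjectionOnto (EuclideanSpace.single x (1 : ℝ)))
          (u : zeroRowSum S A) := by
    intro u
    rw [← hx]
    congr 1
    · exact (Submodule.inner_orthogonalProjectionOnto_eq_of_mem_right _ _).symm
    · exact (Submodule.inner_orthogonalProjectionOnto_eq_of_mem_right _ _).symm
  simp only [h]
  rw [integral_inner_mul_inner_uniformSphere, ← hx, real_inner_comm,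
    Submodule.starProjection_apply, ← Submodule.inner_orthogonalProjectionOnto_eq_of_mem_right]

end UniformDirection

end PerfRL

namespace PerfRL

/-! ### Hoeffding bound and evaluation at random points -/

section Concentration

variable {Ω : Type*} [MeasurableSpace Ω] {P : Measure Ω} [IsProbabilityMeasure P]

/-- Two-sided **Hoeffding inequality** for independent bounded variables with a common mean. -/
theorem measure_le_abs_sum_sub_le {N : ℕ} {Y : Fin N → Ω → ℝ} (hind : iIndepFun Y P)
    (hm : ∀ i, AEMeasurable (Y i) P) {B : ℝ} (hB : 0 < B) (hY : ∀ i, ∀ᵐ ω ∂P, |Y i ω| ≤ B)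
    {c : ℝ} (hc : ∀ i, ∫ ω, Y i ω ∂P = c) (hN : 0 < N) {θ : ℝ} (hθ : 0 < θ) (hθ2 : θ ≤ 2) :
    P {ω | N * (B * √(2 / N * Real.log (2 / θ))) ≤ |∑ i, (Y i ω - c)|} ≤ ENNReal.ofReal θ := by
  set t : ℝ := N * (B * √(2 / N * Real.log (2 / θ))) with ht
  have hN' : (0 : ℝ) < N := by exact_mod_cast hN
  have hlog : 0 ≤ Real.log (2 / θ) := Real.log_nonneg (by rw [le_div_iff₀ hθ]; linarith)
  have ht0 : 0 ≤ t := by positivity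
  -- The threshold `t` is tuned so that the sub-Gaussian exponent `-t²/(2NB²)` equals `log (θ/2)`,
  -- half of `θ` for each tail.
  have ht2 : t ^ 2 = 2 * (N * B ^ 2) * Real.log (2 / θ) := by
    rw [ht, mul_pow, mul_pow, Real.sq_sqrt (by positivity)]
    field_simp
  let v : NNReal := (‖B - -B‖₊ / 2) ^ 2
  have hv : (v : ℝ) = B ^ 2 := by
    simp only [v, NNReal.coe_pow, NNReal.coe_div, coe_nnnorm, NNReal.coe_ofNat]
    rw [Real.norm_of_nonneg (by linarith)]
    ring
  have hsub : ∀ i, HasSubgaussianMGF (fun ω => Y i ω - c) v P := by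
    intro i
    have := hasSubgaussianMGF_of_mem_Icc (a := -B) (b := B) (hm i)
      ((hY i).mono fun ω h => abs_le.1 h)
    rwa [hc i] at this
  have htail : ∀ X : Fin N → Ω → ℝ, iIndepFun X P → (∀ i, HasSubgaussianMGF (X i) v P) →
      P.real {ω | t ≤ ∑ i, X i ω} ≤ θ / 2 := by
    intro X hX hsX
    refine (HasSubgaussianMGF.measure_sum_ge_le_of_iIndepFun hX (c := fun _ => v)
      (s := Finset.univ) (fun i _ => hsX i) ht0).trans (le_of_eq ?_)
    have : -t ^ 2 / (2 * ∑ _i : Fin N, (v : ℝ)) = Real.log (θ / 2) := by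
      rw [ht2, Finset.sum_const, Finset.card_univ, Fintype.card_fin, nsmul_eq_mul, hv,
        Real.log_div hθ.ne' two_ne_zero, Real.log_div two_ne_zero hθ.ne']
      field_simp
      ring
    simp only [NNReal.coe_sum, this]
    exact Real.exp_log (by positivity)
  have hind' : iIndepFun (fun i ω => Y i ω - c) P :=
    hind.comp (fun _ y => y - c) fun _ => by fun_prop
  have hind'' : iIndepFun (fun i ω => -(Y i ω - c)) P :=
    hind.comp (fun _ y => -(y - c)) fun _ => by fun_prop
  have h1 := htail _ hind' hsub
  have h2 := htail _ hind'' fun i => (hsub i).neg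
  have hset : {ω | t ≤ |∑ i, (Y i ω - c)|}
      ⊆ {ω | t ≤ ∑ i, (Y i ω - c)} ∪ {ω | t ≤ ∑ i, -(Y i ω - c)} := by
    intro ω hω
    rcases le_abs.1 (Set.mem_ofPred_eq ▸ hω) with h | h
    · exact Or.inl h
    · right
      rw [Set.mem_ofPred_eq, Finset.sum_neg_distrib]
      exact h
  refine (ENNReal.le_ofReal_iff_toReal_le (measure_ne_top _ _) hθ.le).2 ?_
  calc _ ≤ P.real ({ω | t ≤ ∑ i, (Y i ω - c)} ∪ {ω | t ≤ ∑ i, -(Y i ω - c)}) :=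
        measureReal_mono hset
    _ ≤ _ := measureReal_union_le _ _
    _ ≤ θ / 2 + θ / 2 := add_le_add h1 h2
    _ = θ := by ring

/-- A randomized evaluation that is accurate with high probability at each fixed point is as
accurate at an independent random point. -/
theorem measure_evaluation_error_le {X Ξ : Type*} [MeasurableSpace X] [MeasurableSpace Ξ]
    {μ : Measure X} [IsProbabilityMeasure μ] {ν : Measure Ξ} [IsProbabilityMeasure ν]
    {f : X → Ξ → ℝ} (hf : Measurable (Function.uncurry f)) {v : X → ℝ} (hv : Measurable v)
    {ε θ : ℝ}
    (h : ∀ᵐ x ∂μ, ENNReal.ofReal (1 - θ) ≤ ν {ξ | |f x ξ - v x| ≤ ε})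
    {U : Ω → X} {ξ : Ω → Ξ} (hU : HasLaw U μ P) (hξ : HasLaw ξ ν P) (hind : IndepFun U ξ P) :
    P {ω | ¬ |f (U ω) (ξ ω) - v (U ω)| ≤ ε} ≤ ENNReal.ofReal θ := by
  have hm : Measurable fun z : X × Ξ => |f z.1 z.2 - v z.1| :=
    (hf.sub (hv.comp measurable_fst)).norm
  have hbad : MeasurableSet {z : X × Ξ | ¬ |f z.1 z.2 - v z.1| ≤ ε} :=
    (measurableSet_le hm measurable_const).compl
  -- By independence the pair has the product law, and the failure probability is the average over
  -- `x` of failures at fixed `x`.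
  have heq := (hind.hasLaw_prod hU hξ).measure_eq hbad
  rw [heq, Measure.prod_apply hbad]
  calc _ ≤ ∫⁻ _x, ENNReal.ofReal θ ∂μ := by
        refine lintegral_mono_ae (h.mono fun x hx => ?_)
        have hms : MeasurableSet {ξ | |f x ξ - v x| ≤ ε} :=
          measurableSet_le (hm.comp measurable_prodMk_left) measurable_const
        change ν {ξ | |f x ξ - v x| ≤ ε}ᶜ ≤ _
        rw [prob_compl_eq_one_sub hms]
        refine (tsub_le_tsub_left hx 1).trans ?_
        rw [← ENNReal.ofReal_one, tsub_le_iff_right]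
        refine le_trans (le_of_eq ?_) ENNReal.ofReal_add_le
        rw [add_sub_cancel]
    _ = ENNReal.ofReal θ := by simp

end Concentration

/-! ### Deterministic effect of evaluation errors -/

section Estimator

variable {S A : Type*} [Fintype S] [Fintype A]

theorem norm_le_card_mul {ι : Type*} [Fintype ι] {v : EuclideanSpace ℝ ι} {c : ℝ}
    (h : ∀ x, |v x| ≤ c) : ‖v‖ ≤ Fintype.card ι * c := by
  classical
  have hv : v = ∑ x, v x • EuclideanSpace.single x (1 : ℝ) := by
    ext y
    simp [Finset.sum_apply, Pi.single_apply]
  rw [hv]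
  refine (norm_sum_le _ _).trans ?_
  calc ∑ x, ‖v x • EuclideanSpace.single x (1 : ℝ)‖ ≤ ∑ _x : ι, c := by
        refine Finset.sum_le_sum fun x _ => ?_
        rw [norm_smul, PiLp.norm_single, norm_one, mul_one]
        exact h x
    _ = Fintype.card ι * c := by rw [Finset.sum_const, Finset.card_univ, nsmul_eq_mul]

theorem norm_twoPointEstimator_sub_le {N : ℕ} (hN : 0 < N) {δ ε : ℝ} (hδ : 0 < δ)
    {u : Fin N → PolicyVec S A} (hu : ∀ i, ‖u i‖ = 1) {vp vm wp wm : Fin N → ℝ}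
    (hp : ∀ i, |vp i - wp i| ≤ ε) (hm : ∀ i, |vm i - wm i| ≤ ε)
    (hd : 0 ≤ (Fintype.card S : ℝ) * ((Fintype.card A : ℝ) - 1)) :
    ‖twoPointEstimator δ u vp vm - twoPointEstimator δ u wp wm‖ ≤
      (Fintype.card S : ℝ) * ((Fintype.card A : ℝ) - 1) * ε / δ := by
  have hN' : (0 : ℝ) < N := by exact_mod_cast hN
  rw [twoPointEstimator, twoPointEstimator, ← smul_sub, ← Finset.sum_sub_distrib, norm_smul,
    Real.norm_of_nonneg (by positivity)]
  have h : ‖∑ i, ((vp i - vm i) • u i - (wp i - wm i) • u i)‖ ≤ N * (2 * ε) := by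
    refine (norm_sum_le _ _).trans ?_
    calc _ ≤ ∑ _i : Fin N, 2 * ε := by
          refine Finset.sum_le_sum fun i _ => ?_
          rw [← sub_smul, norm_smul, hu i, mul_one, Real.norm_eq_abs]
          have h1 := abs_le.1 (hp i)
          have h2 := abs_le.1 (hm i)
          rw [abs_le]
          constructor <;> linarith
      _ = N * (2 * ε) := by
          rw [Finset.sum_const, Finset.card_univ, Fintype.card_fin, nsmul_eq_mul]
  refine (mul_le_mul_of_nonneg_left h (by positivity)).trans (le_of_eq ?_)
  field_simp

end Estimator

/-! ### Bias of the two-point estimator -/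

section Mean

variable {S A : Type*} [Fintype S] [Fintype A] [Nontrivial (zeroRowSum S A)]

/-- The bias of one summand of the two-point estimator, for a function with a symmetric first-order
expansion with remainder `q`. -/
theorem abs_integral_sub_starProjection_le {δ q : ℝ} (hδ : 0 < δ) (hq : 0 ≤ q)
    {w : PolicyVec S A → ℝ} (hw : Measurable w) {g : PolicyVec S A}
    (h : ∀ u ∈ unitDirections S A, |w u - 2 * δ * inner ℝ g u| ≤ q) (x : S × A) :
    |∫ u, Module.finrank ℝ (zeroRowSum S A) / (2 * δ) * (w u * u x) ∂(uniformDirection S A)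
        - (zeroRowSum S A).starProjection g x| ≤
      Module.finrank ℝ (zeroRowSum S A) / (2 * δ) * q := by
  have := isProbabilityMeasure_uniformDirection (S := S) (A := A)
  set d : ℝ := (Module.finrank ℝ (zeroRowSum S A) : ℝ)
  have hd : 0 < d :=
    Nat.cast_pos.2 (Module.finrank_pos (R := ℝ) (M := zeroRowSum S A))
  have hux : ∀ u ∈ unitDirections S A, |u x| ≤ 1 := fun u hu =>
    (abs_apply_le_norm u x).trans hu.1.le
  have hx : Measurable fun u : PolicyVec S A => u x := by
    have : Continuous fun u : PolicyVec S A => u x := by fun_prop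
    exact this.measurable
  have hg : Measurable fun u : PolicyVec S A => inner ℝ g u := by
    have : Continuous fun u : PolicyVec S A => inner ℝ g u := by fun_prop
    exact this.measurable
  have hgb : ∀ u ∈ unitDirections S A, |inner ℝ g u| ≤ ‖g‖ := fun u hu => by
    simpa [hu.1] using abs_real_inner_le_norm g u
  have hwb : ∀ u ∈ unitDirections S A, |w u| ≤ q + 2 * δ * ‖g‖ := by
    intro u hu
    have h1 := abs_le.1 (h u hu)
    have h2 := abs_le.1 (hgb u hu)
    rw [abs_le]
    constructor <;> nlinarith
  have hint1 : Integrable (fun u => d / (2 * δ) * (w u * u x)) (uniformDirection S A) := by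
    refine Integrable.const_mul (Integrable.of_bound (hw.mul hx).aestronglyMeasurable
      ((q + 2 * δ * ‖g‖) * 1) (ae_mem_unitDirections.mono fun u hu => ?_)) _
    rw [Pi.mul_apply, norm_mul]
    exact mul_le_mul (hwb u hu) (hux u hu) (abs_nonneg _) (by positivity)
  have hint2 : Integrable (fun u => d * (inner ℝ g u * u x)) (uniformDirection S A) := by
    refine Integrable.const_mul (Integrable.of_bound (hg.mul hx).aestronglyMeasurable
      (‖g‖ * 1) (ae_mem_unitDirections.mono fun u hu => ?_)) _
    rw [Pi.mul_apply, norm_mul]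
    exact mul_le_mul (hgb u hu) (hux u hu) (abs_nonneg _) (by positivity)
  have hproj : (zeroRowSum S A).starProjection g x
      = ∫ u, d * (inner ℝ g u * u x) ∂(uniformDirection S A) := by
    rw [integral_const_mul, integral_inner_mul_apply, mul_div_cancel₀ _ hd.ne']
  rw [hproj, ← integral_sub hint1 hint2, ← Real.norm_eq_abs]
  have hb : ∀ᵐ u ∂(uniformDirection S A),
      ‖d / (2 * δ) * (w u * u x) - d * (inner ℝ g u * u x)‖ ≤ d / (2 * δ) * q := by
    refine ae_mem_unitDirections.mono fun u hu => ?_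
    have : d / (2 * δ) * (w u * u x) - d * (inner ℝ g u * u x)
        = d / (2 * δ) * ((w u - 2 * δ * inner ℝ g u) * u x) := by field_simp
    rw [this, norm_mul, Real.norm_of_nonneg (by positivity), norm_mul]
    refine mul_le_mul_of_nonneg_left ?_ (by positivity)
    calc _ ≤ q * 1 := mul_le_mul (h u hu) (hux u hu) (abs_nonneg _) hq
      _ = q := mul_one q
  simpa using norm_integral_le_of_norm_le_const hb

end Mean

end PerfRL

namespace PerfRL

/-! ### High-probability error of the estimator -/

section HighProbability

variable {S A : Type*} [Fintype S] [Fintype A]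

theorem ofReal_one_sub_le_measure {Ω : Type*} [MeasurableSpace Ω] {P : Measure Ω}
    [IsProbabilityMeasure P] {s : Set Ω} {η : ℝ} (hη : 0 ≤ η) (h : P sᶜ ≤ ENNReal.ofReal η) :
    ENNReal.ofReal (1 - η) ≤ P s := by
  rw [ENNReal.ofReal_sub _ hη, ENNReal.ofReal_one, tsub_le_iff_right]
  calc (1 : ENNReal) = P (s ∪ sᶜ) := by rw [Set.union_compl_self, measure_univ]
    _ ≤ P s + P sᶜ := measure_union_le _ _
    _ ≤ P s + ENNReal.ofReal η := by gcongr

theorem measure_iUnion_le_ofReal {Ω ι : Type*} [MeasurableSpace Ω] {P : Measure Ω} [Fintype ι]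
    [Nonempty ι] {s : ι → Set Ω} {c : ℝ}
    (h : ∀ i, P (s i) ≤ ENNReal.ofReal (c / (3 * Fintype.card ι))) :
    P (⋃ i, s i) ≤ ENNReal.ofReal (c / 3) := by
  refine (measure_iUnion_fintype_le P s).trans ((Finset.sum_le_sum fun i _ => h i).trans ?_)
  have hc : (0 : ℝ) < Fintype.card ι := by exact_mod_cast Fintype.card_pos
  rw [Finset.sum_const, Finset.card_univ, nsmul_eq_mul, ← ENNReal.ofReal_natCast,
    ← ENNReal.ofReal_mul hc.le]
  refine le_of_eq (congrArg _ ?_)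
  field_simp

/-- `V` is controlled only on `s`. Cutting off outside the closed set of directions gives a globally
measurable function, and a random direction almost surely does not see the cut. -/
theorem measurable_indicator_unitDirections {V : PolicyVec S A → ℝ} {s : Set (PolicyVec S A)}
    {k : ℝ} (hV : ∀ π ∈ s, ∀ π' ∈ s, |V π' - V π| ≤ k * ‖π' - π‖)
    {f : PolicyVec S A → PolicyVec S A} (hf : Continuous f)
    (hfs : ∀ u ∈ unitDirections S A, f u ∈ s) :
    Measurable ((unitDirections S A).indicator fun u => V (f u)) := by
  classical
  have hVc : ContinuousOn V s := by
    refine (LipschitzOnWith.of_dist_le_mul (K := k.toNNReal) fun x hx y hy => ?_).continuousOn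
    rw [Real.dist_eq, dist_eq_norm]
    refine (hV y hy x hx).trans (mul_le_mul_of_nonneg_right ?_ (norm_nonneg _))
    exact Real.le_coe_toNNReal k
  rw [← Set.piecewise_eq_indicator]
  exact ContinuousOn.measurable_piecewise (hVc.comp hf.continuousOn hfs) continuousOn_const
    isClosed_unitDirections.measurableSet

/-- The estimator is compared with its version using exact values. The latter depends on the
directions alone, so Hoeffding needs independence of the `u i` only; the evaluation runs may depend
on each other, since they enter through a union bound. -/
theorem measure_twoPointEstimator_error_ge {V : PolicyVec S A → ℝ} {Δ δ K q : ℝ} (hδ : 0 < δ)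
    (hδΔ : δ < Δ) (hK : 0 < K) (hq : 0 ≤ q) [Nonempty (S × A)] [Nontrivial (zeroRowSum S A)]
    {π : PolicyVec S A} (hπ : π ∈ policySubset S A Δ)
    (hV : ∀ π ∈ policySubset S A (Δ - δ), ∀ π' ∈ policySubset S A (Δ - δ),
      |V π' - V π| ≤ K * ‖π' - π‖) {g : PolicyVec S A}
    (hg : ∀ u ∈ unitDirections S A,
      |V (π + δ • u) - V (π - δ • u) - 2 * δ * inner ℝ g u| ≤ q)
    {N : ℕ} {η ε : ℝ} (hN : 0 < N) (hη : 0 < η) (hη1 : η < 1)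
    {Ξ : Type*} [MeasurableSpace Ξ] {ν : Measure Ξ} [IsProbabilityMeasure ν]
    {Vhat : PolicyVec S A → Ξ → ℝ} (hVhat : Measurable (Function.uncurry Vhat))
    (herr : ∀ π' ∈ policySet S A,
      ENNReal.ofReal (1 - η / (3 * N)) ≤ ν {ξ | |Vhat π' ξ - V π'| ≤ ε})
    {Ω : Type*} [MeasurableSpace Ω] {P : Measure Ω} [IsProbabilityMeasure P]
    {u : Fin N → Ω → PolicyVec S A} {ξp ξm : Fin N → Ω → Ξ}
    (hu : ∀ i, HasLaw (u i) (uniformDirection S A) P) (hind : iIndepFun u P)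
    (hξp : ∀ i, HasLaw (ξp i) ν P) (hξm : ∀ i, HasLaw (ξm i) ν P)
    (hup : ∀ i, IndepFun (u i) (ξp i) P) (hum : ∀ i, IndepFun (u i) (ξm i) P) :
    ENNReal.ofReal (1 - η) ≤
      P {ω | ‖twoPointEstimator δ (fun i => u i ω)
                (fun i => Vhat (π + δ • u i ω) (ξp i ω))
                (fun i => Vhat (π - δ • u i ω) (ξm i ω))
              - (zeroRowSum S A).starProjection g‖
        ≤ Module.finrank ℝ (zeroRowSum S A) * ε / δ
          + Fintype.card (S × A) * (Module.finrank ℝ (zeroRowSum S A) * K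
              * √(2 / N * Real.log (6 * Fintype.card (S × A) / η))
            + Module.finrank ℝ (zeroRowSum S A) / (2 * δ) * q)} := by
  have hA : Nonempty A := ⟨(Classical.arbitrary (S × A)).2⟩
  have hd_eq := finrank_zeroRowSum (S := S) (A := A)
  set d : ℝ := (Module.finrank ℝ (zeroRowSum S A) : ℝ)
  have hd : 0 < d :=
    Nat.cast_pos.2 (Module.finrank_pos (R := ℝ) (M := zeroRowSum S A))
  have hN' : (0 : ℝ) < N := by exact_mod_cast hN
  have : NeZero N := ⟨hN.ne'⟩
  have := isProbabilityMeasure_uniformDirection (S := S) (A := A)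
  have hmem_p : ∀ u ∈ unitDirections S A, π + δ • u ∈ policySubset S A (Δ - δ) := fun u hu =>
    add_smul_mem_policySubset hδ.le hδΔ.le hπ hu.1.le hu.2
  have hmem_m : ∀ u ∈ unitDirections S A, π - δ • u ∈ policySubset S A (Δ - δ) := fun u hu =>
    sub_smul_mem_policySubset hδ.le hδΔ.le hπ hu.1.le hu.2
  set wp := (unitDirections S A).indicator fun u => V (π + δ • u) with hwp_def
  set wm := (unitDirections S A).indicator fun u => V (π - δ • u) with hwm_def
  have hwp : Measurable wp := measurable_indicator_unitDirections hV (by fun_prop) hmem_p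
  have hwm : Measurable wm := measurable_indicator_unitDirections hV (by fun_prop) hmem_m
  have hwp_eq : ∀ u ∈ unitDirections S A, wp u = V (π + δ • u) := fun u hu =>
    Set.indicator_of_mem hu _
  have hwm_eq : ∀ u ∈ unitDirections S A, wm u = V (π - δ • u) := fun u hu =>
    Set.indicator_of_mem hu _
  let φ : S × A → PolicyVec S A → ℝ := fun x u => d / (2 * δ) * ((wp u - wm u) * u x)
  have hφ : ∀ x, Measurable (φ x) := by
    intro x
    have hx : Continuous fun u : PolicyVec S A => u x := by fun_prop
    exact ((hwp.sub hwm).mul hx.measurable).const_mul _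
  have hmean : ∀ x, |∫ u, φ x u ∂(uniformDirection S A) - (zeroRowSum S A).starProjection g x|
      ≤ d / (2 * δ) * q :=
    abs_integral_sub_starProjection_le hδ hq (hwp.sub hwm) fun u hu => by
      rw [Pi.sub_apply, hwp_eq u hu, hwm_eq u hu]
      exact hg u hu
  have hφb : ∀ x, ∀ u ∈ unitDirections S A, |φ x u| ≤ d * K := by
    intro x u hu
    have h1 := hV _ (hmem_m u hu) _ (hmem_p u hu)
    have h2 : π + δ • u - (π - δ • u) = (2 * δ) • u := by module
    rw [h2, norm_smul, hu.1, Real.norm_of_nonneg (by positivity), mul_one] at h1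
    have h3 := (abs_apply_le_norm u x).trans hu.1.le
    simp only [φ]
    rw [abs_mul, abs_mul, abs_of_nonneg (by positivity : 0 ≤ d / (2 * δ)), hwp_eq u hu,
      hwm_eq u hu]
    calc d / (2 * δ) * (|V (π + δ • u) - V (π - δ • u)| * |u x|)
        ≤ d / (2 * δ) * (K * (2 * δ) * 1) := by gcongr
      _ = d * K := by field_simp
  have hmemD : ∀ i, ∀ᵐ ω ∂P, u i ω ∈ unitDirections S A := fun i =>
    ae_of_ae_map (hu i).aemeasurable ((hu i).map_eq.symm ▸ ae_mem_unitDirections)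
  set n : ℕ := Fintype.card (S × A) with hn
  have hn0 : 0 < n := Fintype.card_pos
  have hn1 : (1 : ℝ) ≤ n := by exact_mod_cast hn0
  set R : ℝ := √(2 / N * Real.log (6 * n / η)) with hR
  let badD : Fin N → Set Ω := fun i => {ω | ¬ u i ω ∈ unitDirections S A}
  let badP : Fin N → Set Ω := fun i =>
    {ω | ¬ |Vhat (π + δ • u i ω) (ξp i ω) - wp (u i ω)| ≤ ε}
  let badM : Fin N → Set Ω := fun i =>
    {ω | ¬ |Vhat (π - δ • u i ω) (ξm i ω) - wm (u i ω)| ≤ ε}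
  let badF : S × A → Set Ω := fun x =>
    {ω | N * (d * K * R) ≤ |∑ i, (φ x (u i ω) - ∫ v, φ x v ∂(uniformDirection S A))|}
  have hD : P (⋃ i, badD i) = 0 := measure_iUnion_null fun i => hmemD i
  have hP : P (⋃ i, badP i) ≤ ENNReal.ofReal (η / 3) := by
    refine measure_iUnion_le_ofReal fun i => ?_
    rw [Fintype.card_fin]
    refine measure_evaluation_error_le (f := fun v ξ => Vhat (π + δ • v) ξ) ?_ hwp ?_
      (hu i) (hξp i) (hup i)
    · have : Continuous fun v : PolicyVec S A => π + δ • v := by fun_prop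
      exact hVhat.comp ((this.measurable.comp measurable_fst).prodMk measurable_snd)
    · refine ae_mem_unitDirections.mono fun v hv => ?_
      rw [hwp_eq v hv]
      exact herr _ (hmem_p v hv).1
  have hM : P (⋃ i, badM i) ≤ ENNReal.ofReal (η / 3) := by
    refine measure_iUnion_le_ofReal fun i => ?_
    rw [Fintype.card_fin]
    refine measure_evaluation_error_le (f := fun v ξ => Vhat (π - δ • v) ξ) ?_ hwm ?_
      (hu i) (hξm i) (hum i)
    · have : Continuous fun v : PolicyVec S A => π - δ • v := by fun_prop
      exact hVhat.comp ((this.measurable.comp measurable_fst).prodMk measurable_snd)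
    · refine ae_mem_unitDirections.mono fun v hv => ?_
      rw [hwm_eq v hv]
      exact herr _ (hmem_m v hv).1
  have hF : P (⋃ x, badF x) ≤ ENNReal.ofReal (η / 3) := by
    refine measure_iUnion_le_ofReal fun x => ?_
    -- Each of the `n` coordinates gets failure probability `η/(3n)`, whence the logarithm of `2/θ =
    -- 6n/η`.
    have h := measure_le_abs_sum_sub_le (P := P) (Y := fun i ω => φ x (u i ω))
      (hind.comp (fun _ => φ x) fun _ => hφ x)
      (fun i => (hφ x).comp_aemeasurable (hu i).aemeasurable) (mul_pos hd hK)
      (fun i => (hmemD i).mono fun ω hω => hφb x _ hω)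
      (fun i => (hu i).integral_comp (hφ x).aestronglyMeasurable) hN
      (θ := η / (3 * n)) (by positivity)
      (by rw [div_le_iff₀ (by positivity)]; linarith)
    have hlog : 2 / (η / (3 * (n : ℝ))) = 6 * n / η := by field_simp; norm_num
    rw [hlog] at h
    exact h
  refine ofReal_one_sub_le_measure hη.le ?_
  have hsub : {ω | ‖twoPointEstimator δ (fun i => u i ω)
                (fun i => Vhat (π + δ • u i ω) (ξp i ω))
                (fun i => Vhat (π - δ • u i ω) (ξm i ω))
              - (zeroRowSum S A).starProjection g‖
        ≤ d * ε / δ + n * (d * K * R + d / (2 * δ) * q)}ᶜ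
      ⊆ (⋃ i, badD i) ∪ (⋃ i, badP i) ∪ (⋃ i, badM i) ∪ (⋃ x, badF x) := by
    intro ω hω
    by_contra hgood
    simp only [Set.mem_union, Set.mem_iUnion, not_or, not_exists, badD, badP, badM, badF,
      Set.mem_ofPred_eq, not_not, not_le] at hgood
    obtain ⟨⟨⟨h1, h2⟩, h3⟩, h4⟩ := hgood
    refine hω ?_
    rw [Set.mem_ofPred_eq]
    refine (norm_sub_le_norm_sub_add_norm_sub _
      (twoPointEstimator δ (fun i => u i ω) (fun i => wp (u i ω)) fun i => wm (u i ω)) _).trans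
      (add_le_add ?_ ?_)
    · have h := norm_twoPointEstimator_sub_le hN hδ (fun i => (h1 i).1)
        (fun i => not_lt.1 (h2 i)) (fun i => not_lt.1 (h3 i))
        (by rw [← hd_eq]; exact hd.le)
      rwa [← hd_eq] at h
    · refine norm_le_card_mul fun x => ?_
      have he : twoPointEstimator δ (fun i => u i ω) (fun i => wp (u i ω))
          (fun i => wm (u i ω)) x = (∑ i, φ x (u i ω)) / N := by
        rw [twoPointEstimator, ← hd_eq]
        simp only [φ, PiLp.smul_apply, smul_eq_mul, WithLp.ofLp_sum, Finset.sum_apply]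
        rw [← Finset.mul_sum]
        field_simp
      have h5 := h4 x
      rw [Finset.sum_sub_distrib, Finset.sum_const, Finset.card_univ, Fintype.card_fin,
        nsmul_eq_mul] at h5
      have h6 : |(∑ i, φ x (u i ω)) / N - ∫ v, φ x v ∂(uniformDirection S A)| ≤ d * K * R := by
        rw [← mul_le_mul_iff_right₀ hN', ← abs_of_pos hN', ← abs_mul, abs_of_pos hN', mul_sub,
          mul_div_cancel₀ _ hN'.ne']
        exact h5.le
      rw [PiLp.sub_apply, he]
      exact (abs_sub_le _ _ _).trans (add_le_add h6 (hmean x))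
  calc _ ≤ P ((⋃ i, badD i) ∪ (⋃ i, badP i) ∪ (⋃ i, badM i) ∪ (⋃ x, badF x)) :=
        measure_mono hsub
    _ ≤ P (⋃ i, badD i) + P (⋃ i, badP i) + P (⋃ i, badM i) + P (⋃ x, badF x) := by
        refine (measure_union_le _ _).trans (add_le_add_left ?_ _)
        refine (measure_union_le _ _).trans (add_le_add_left ?_ _)
        exact measure_union_le _ _
    _ ≤ 0 + ENNReal.ofReal (η / 3) + ENNReal.ofReal (η / 3) + ENNReal.ofReal (η / 3) := by
        rw [hD]; gcongr
    _ = ENNReal.ofReal η := by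
        rw [zero_add, ← ENNReal.ofReal_add (by positivity) (by positivity),
          ← ENNReal.ofReal_add (by positivity) (by positivity)]
        congr 1
        ring

end HighProbability

/-! ### Comparison of the explicit bounds -/

section ErrorBound

/-- From `N/η ≥ 2` the logarithm `x = log (N/η)` is at least `log 2`. This lets `c` absorb `log
(3n)` into a multiple of `x`, and replaces `√x` by a multiple of `x`. -/
theorem errorBound_le_order (S A : Type*) [Fintype S] [Fintype A] [Nonempty (S × A)] {L l : ℝ}
    (hL : 0 ≤ L) (hl : 0 ≤ l) {Δ δ εV η : ℝ} (hδ : 0 < δ) (hδΔ : δ < Δ) (hΔ : Δ - δ ≤ 1)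
    (hεV : 0 ≤ εV) (hη : 0 < η) {N : ℕ} (hN : 0 < N) (hNη : 2 * η ≤ N)
    {n c : ℝ} (hn : n = Fintype.card S * Fintype.card A)
    (hc : c = Real.log (3 * n) / Real.log 2 + 1) :
    errorBound S A L l Δ δ εV η N ≤
      (2 * n + 4 * L * n * c / 3 + L * n * √(2 * c / Real.log 2) + l) / (Δ - δ)
        * (εV / δ + Real.log (N / η) / √N + δ) := by
  have hn1 : 1 ≤ n := by
    have : 0 < Fintype.card (S × A) := Fintype.card_pos
    rw [Fintype.card_prod] at this
    rw [hn]
    exact_mod_cast this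
  have hN1 : (1 : ℝ) ≤ N := by exact_mod_cast hN
  have hN0 : (0 : ℝ) < N := by linarith
  have hm : 0 < Δ - δ := by linarith
  have hlog2 : 0 < Real.log 2 := Real.log_pos one_lt_two
  have hc0 : 0 < c := by
    have := Real.log_nonneg (by linarith : 1 ≤ 3 * n)
    rw [hc]; positivity
  have hsq : 0 < √(N : ℝ) := Real.sqrt_pos.2 hN0
  set x := Real.log (N / η) with hx
  have hx2 : Real.log 2 ≤ x := Real.log_le_log two_pos (by rwa [le_div_iff₀ hη])
  have hx0 : 0 < x := by linarith
  have hlog : Real.log (3 * N * Fintype.card S * Fintype.card A / η) ≤ c * x := by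
    have h1 : 3 * (N : ℝ) * Fintype.card S * Fintype.card A / η = 3 * n * (N / η) := by
      rw [hn]; ring
    rw [h1, Real.log_mul (by positivity) (by positivity), hc, add_mul, one_mul, ← hx]
    gcongr
    rw [div_mul_eq_mul_div, le_div_iff₀ hlog2]
    exact mul_le_mul_of_nonneg_left hx2 (Real.log_nonneg (by linarith))
  have hNsq : 1 / (N : ℝ) ≤ 1 / √N := by
    refine one_div_le_one_div_of_le hsq ?_
    rw [Real.sqrt_le_left (by linarith)]
    nlinarith
  have t1 : 2 * Fintype.card S * Fintype.card A * εV / δ ≤ 2 * n / (Δ - δ) * (εV / δ) := by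
    have : 2 * (Fintype.card S : ℝ) * Fintype.card A * εV / δ = 2 * n * (εV / δ) := by
      rw [hn]; ring
    rw [this]
    gcongr
    exact le_div_self (by positivity) hm hΔ
  have t2 : 4 * L * Fintype.card S * Fintype.card A / (3 * N * (Δ - δ))
        * Real.log (3 * N * Fintype.card S * Fintype.card A / η)
      ≤ 4 * L * n * c / 3 / (Δ - δ) * (x / √N) := by
    calc _ ≤ 4 * L * Fintype.card S * Fintype.card A / (3 * N * (Δ - δ)) * (c * x) := by
          gcongr
      _ = 4 * L * n * c / 3 / (Δ - δ) * (x * (1 / N)) := by rw [hn]; field_simp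
      _ ≤ 4 * L * n * c / 3 / (Δ - δ) * (x * (1 / √N)) := by gcongr
      _ = _ := by ring
  have t3 : L * Fintype.card S * Fintype.card A / (Δ - δ)
        * √(2 / N * Real.log (3 * N * Fintype.card S * Fintype.card A / η))
      ≤ L * n * √(2 * c / Real.log 2) / (Δ - δ) * (x / √N) := by
    have h1 : √(2 / N * Real.log (3 * N * Fintype.card S * Fintype.card A / η))
        ≤ √(2 * c / Real.log 2) * (x / √N) := by
      have h2 : √(2 * c / Real.log 2) * (x / √N) = √(2 * c / Real.log 2 * (x ^ 2 / N)) := by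
        rw [Real.sqrt_mul (by positivity), Real.sqrt_div (sq_nonneg x), Real.sqrt_sq hx0.le]
      rw [h2]
      refine Real.sqrt_le_sqrt ?_
      calc _ ≤ 2 / N * (c * x) := by gcongr
        _ = 2 * c * (x * Real.log 2) / (Real.log 2 * N) := by field_simp
        _ ≤ 2 * c * (x * x) / (Real.log 2 * N) := by gcongr
        _ = _ := by field_simp
    calc _ ≤ L * Fintype.card S * Fintype.card A / (Δ - δ)
          * (√(2 * c / Real.log 2) * (x / √N)) := by gcongr
      _ = _ := by rw [hn]; ring
  have t4 : δ * l / (Δ - δ) = l / (Δ - δ) * δ := by ring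
  have e1 : 0 ≤ εV / δ := by positivity
  have e2 : 0 ≤ x / √N := by positivity
  set a₁ := 2 * n / (Δ - δ) with ha₁
  set a₂ := 4 * L * n * c / 3 / (Δ - δ) with ha₂
  set a₃ := L * n * √(2 * c / Real.log 2) / (Δ - δ) with ha₃
  set a₄ := l / (Δ - δ) with ha₄
  have p₁ : 0 ≤ a₁ := by positivity
  have p₂ : 0 ≤ a₂ := by positivity
  have p₃ : 0 ≤ a₃ := by positivity
  have p₄ : 0 ≤ a₄ := by positivity
  rw [add_div, add_div, add_div, ← ha₁, ← ha₂, ← ha₃, ← ha₄, errorBound, t4]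
  have s1 : a₁ * (εV / δ) ≤ (a₁ + a₂ + a₃ + a₄) * (εV / δ) := by gcongr; linarith
  have s2 : (a₂ + a₃) * (x / √N) ≤ (a₁ + a₂ + a₃ + a₄) * (x / √N) :=
    mul_le_mul_of_nonneg_right (by linarith) e2
  have s3 : a₄ * δ ≤ (a₁ + a₂ + a₃ + a₄) * δ := by gcongr; linarith
  linarith

/-- Rests on `6n/η ≤ (3Nn/η)²`. Evaluation error, fluctuation and bias go into the first, third and
fourth terms of `errorBound`; the second is only nonnegative. -/
theorem le_errorBound {S A : Type*} [Fintype S] [Fintype A] [Nonempty (S × A)]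
    {d n K Q L l Δ δ εV η : ℝ} {N : ℕ} (hδ : 0 < δ) (hδΔ : δ < Δ) (hεV : 0 ≤ εV) (hη : 0 < η)
    (hη1 : η < 1) (hN : 0 < N) (hn : n = Fintype.card S * Fintype.card A)
    (hdn : d ≤ n) (hK : 0 ≤ K) (hQ : 0 ≤ Q)
    (hL : 2 * n * K ≤ L) (hl : n ^ 2 * Q ≤ l) :
    d * εV / δ + n * (d * (K / (Δ - δ)) * √(2 / N * Real.log (6 * n / η))
      + d / (2 * δ) * (2 * (Q / (Δ - δ) * δ ^ 2))) ≤ errorBound S A L l Δ δ εV η N := by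
  have hn1 : 1 ≤ n := by
    have : 0 < Fintype.card (S × A) := Fintype.card_pos
    rw [Fintype.card_prod] at this
    rw [hn]
    exact_mod_cast this
  have hN1 : (1 : ℝ) ≤ N := by exact_mod_cast hN
  have hN0 : (0 : ℝ) < N := by linarith
  have hm : 0 < Δ - δ := by linarith
  have hL0 : 0 ≤ L := le_trans (by positivity) hL
  set Λ := Real.log (3 * N * Fintype.card S * Fintype.card A / η) with hΛ
  have harg : 3 * (N : ℝ) * Fintype.card S * Fintype.card A / η = 3 * N * n / η := by
    rw [hn]; ring
  have hy : 3 ≤ 3 * N * n / η := by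
    rw [le_div_iff₀ hη]
    nlinarith [mul_le_mul hN1 hn1 zero_le_one (by linarith)]
  have hΛ0 : 0 ≤ Λ := by
    rw [hΛ, harg]
    exact Real.log_nonneg (by linarith)
  have hlog : Real.log (6 * n / η) ≤ 2 * Λ := by
    have h1 : 6 * n / η ≤ (3 * N * n / η) ^ 2 := by
      calc 6 * n / η = 2 * (3 * 1 * n / η) := by ring
        _ ≤ 3 * N * n / η * (3 * N * n / η) := by
            gcongr
            linarith
        _ = _ := by ring
    have h2 := Real.log_le_log (by positivity) h1
    rw [Real.log_pow] at h2
    rw [hΛ, harg]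
    exact_mod_cast h2
  have hroot : √(2 / N * Real.log (6 * n / η)) ≤ 2 * √(2 / N * Λ) := by
    have h4 : 2 * √(2 / N * Λ) = √(4 * (2 / N * Λ)) := by
      rw [Real.sqrt_mul (by norm_num : (0 : ℝ) ≤ 4), (by norm_num : (4 : ℝ) = 2 ^ 2),
        Real.sqrt_sq two_pos.le]
    rw [h4]
    refine Real.sqrt_le_sqrt ?_
    calc 2 / N * Real.log (6 * n / η) ≤ 2 / N * (2 * Λ) := by gcongr
      _ ≤ 4 * (2 / N * Λ) := by nlinarith [(by positivity : 0 ≤ 2 / (N : ℝ) * Λ)]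
  have t1 : d * εV / δ ≤ 2 * Fintype.card S * Fintype.card A * εV / δ := by
    rw [mul_assoc 2, ← hn]
    gcongr
    linarith
  have t2 : 0 ≤ 4 * L * Fintype.card S * Fintype.card A / (3 * N * (Δ - δ)) * Λ := by positivity
  have t3 : n * (d * (K / (Δ - δ)) * √(2 / N * Real.log (6 * n / η)))
      ≤ L * Fintype.card S * Fintype.card A / (Δ - δ) * √(2 / N * Λ) := by
    rw [mul_assoc L, ← hn]
    calc _ ≤ n * (n * (K / (Δ - δ)) * (2 * √(2 / N * Λ))) := by gcongr
      _ = 2 * n * K * n / (Δ - δ) * √(2 / N * Λ) := by ring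
      _ ≤ _ := by gcongr
  have t4 : n * (d / (2 * δ) * (2 * (Q / (Δ - δ) * δ ^ 2))) ≤ δ * l / (Δ - δ) := by
    calc _ = δ * (n * d * Q) / (Δ - δ) := by field_simp
      _ ≤ δ * (n * n * Q) / (Δ - δ) := by gcongr
      _ ≤ _ := by
        rw [← pow_two]
        gcongr
  rw [errorBound, ← hΛ]
  linarith

end ErrorBound

end PerfRL

theorem proposition1 {S A : Type*} [Fintype S] [Fintype A]
    [MeasurableSpace S] [MeasurableSingletonClass S]
    [MeasurableSpace A] [MeasurableSingletonClass A]
    (γ lam εp εr Sp Sr : ℝ) (hγ0 : 0 < γ) (hγ1 : γ < 1) (hlam : 0 ≤ lam)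
    (hεp : 0 ≤ εp) (hεr : 0 ≤ εr) (hSp : 0 ≤ Sp) (hSr : 0 ≤ Sr) :
    -- the constants depend only on `S`, `A`, `γ`, `lam`, `εp`, `εr`, `Sp`, `Sr`
    ∃ L > 0, ∃ l > 0, ∃ C > 0,
    ∀ M : PerfRL.PerformativeMDP S A, M.Sensitive εp εr → M.Smooth Sp Sr →
    ∀ Δ δ : ℝ, 0 < δ → δ < Δ → ∀ π ∈ PerfRL.policySubset S A Δ,
      -- the perturbed policies are policies
      (∀ u ∈ PerfRL.unitDirections S A,
        π + δ • u ∈ PerfRL.policySet S A ∧ π - δ • u ∈ PerfRL.policySet S A) ∧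
      -- the performative value function has a gradient at `π`
      (∃ g, HasGradientWithinAt (M.perfValue γ lam) g (PerfRL.policySet S A) π) ∧
      -- the error bounds, for every gradient (they all have the same projection)
      ∀ g, HasGradientWithinAt (M.perfValue γ lam) g (PerfRL.policySet S A) π →
      ∀ (N : ℕ) (η εV : ℝ), 0 < N → 0 < η → η < 1 → 0 ≤ εV →
      -- a randomized policy evaluation `Vhat` with internal randomness of law `ν`, whose error
      -- at each policy is at most `εV` with probability at least `1 - η / (3 N)`
      ∀ (Ξ : Type*) [MeasurableSpace Ξ] (ν : MeasureTheory.Measure Ξ)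
        [MeasureTheory.IsProbabilityMeasure ν] (Vhat : PerfRL.PolicyVec S A → Ξ → ℝ),
        Measurable (Function.uncurry Vhat) →
        (∀ π' ∈ PerfRL.policySet S A,
          ENNReal.ofReal (1 - η / (3 * N)) ≤
            ν {ξ | |Vhat π' ξ - M.perfValue γ lam π'| ≤ εV}) →
      -- i.i.d. uniform directions `u i`, and runs of `Vhat` at `π ± δ u_i` whose internal
      -- randomness `ξp i`, `ξm i` is independent of the point of evaluation
      ∀ (Ω : Type*) [MeasurableSpace Ω] (P : MeasureTheory.Measure Ω)
        [MeasureTheory.IsProbabilityMeasure P]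
        (u : Fin N → Ω → PerfRL.PolicyVec S A) (ξp ξm : Fin N → Ω → Ξ),
        (∀ i, ProbabilityTheory.HasLaw (u i) (PerfRL.uniformDirection S A) P) →
        ProbabilityTheory.iIndepFun u P →
        (∀ i, ProbabilityTheory.HasLaw (ξp i) ν P) →
        (∀ i, ProbabilityTheory.HasLaw (ξm i) ν P) →
        (∀ i, ProbabilityTheory.IndepFun (u i) (ξp i) P) →
        (∀ i, ProbabilityTheory.IndepFun (u i) (ξm i) P) →
        -- the full error bound holds with probability at least `1 - η`
        ENNReal.ofReal (1 - η) ≤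
          P {ω | ‖PerfRL.twoPointEstimator δ (fun i => u i ω)
                    (fun i => Vhat (π + δ • u i ω) (ξp i ω))
                    (fun i => Vhat (π - δ • u i ω) (ξm i ω))
                  - (PerfRL.zeroRowSum S A).starProjection g‖
                ≤ PerfRL.errorBound S A L l Δ δ εV η N} ∧
        -- and it is of the stated order
        (2 * η ≤ N →
          PerfRL.errorBound S A L l Δ δ εV η N ≤
            C / (Δ - δ) * (εV / δ + Real.log (N / η) / √N + δ)) := by
  obtain ⟨K, hK, Q, hQ, hexp⟩ := PerfRL.exists_perfValue_expansion (S := S) (A := A) hγ0 hγ1 hlam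
    hεp hεr hSp hSr
  set n : ℝ := (Fintype.card S : ℝ) * Fintype.card A with hn
  have hn0 : 0 ≤ n := by positivity
  -- `n + 1` in place of `n` keeps the constants positive when `S × A` is empty.
  obtain ⟨L, hL⟩ : ∃ L, L = 2 * (n + 1) * K := ⟨_, rfl⟩
  obtain ⟨l, hl⟩ : ∃ l, l = (n + 1) ^ 2 * Q := ⟨_, rfl⟩
  have hL0 : 0 < L := by rw [hL]; positivity
  have hl0 : 0 < l := by rw [hl]; positivity
  obtain ⟨c, hc⟩ : ∃ c, c = Real.log (3 * n) / Real.log 2 + 1 := ⟨_, rfl⟩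
  have hc0 : 0 ≤ c := by
    have hlog : 0 ≤ Real.log (3 * n) := by
      rw [hn]
      exact_mod_cast Real.log_natCast_nonneg (3 * (Fintype.card S * Fintype.card A))
    rw [hc]
    positivity
  refine ⟨L, hL0, l, hl0, 2 * n + 4 * L * n * c / 3 + L * n * √(2 * c / Real.log 2) + l,
    by positivity, fun M hM hS Δ δ hδ hδΔ π hπ => ?_⟩
  have hm : 0 < Δ - δ := by linarith
  have hne : Nonempty (S × A) := M.nonempty_index hπ.1
  have hm1 : Δ - δ ≤ 1 := by
    obtain ⟨x⟩ := hne
    linarith [hπ.2 x, (hπ.1.1 x).2]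
  have hmem_p : ∀ u ∈ PerfRL.unitDirections S A, π + δ • u ∈ PerfRL.policySubset S A (Δ - δ) :=
    fun u hu => PerfRL.add_smul_mem_policySubset hδ.le hδΔ.le hπ hu.1.le hu.2
  have hmem_m : ∀ u ∈ PerfRL.unitDirections S A, π - δ • u ∈ PerfRL.policySubset S A (Δ - δ) :=
    fun u hu => PerfRL.sub_smul_mem_policySubset hδ.le hδΔ.le hπ hu.1.le hu.2
  have hπm : π ∈ PerfRL.policySubset S A (Δ - δ) := ⟨hπ.1, fun x => by linarith [hπ.2 x]⟩
  obtain ⟨g₀, hg₀⟩ := hexp M hM hS (Δ - δ) hm π hπm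
  have hgrad : HasGradientWithinAt (M.perfValue γ lam) g₀ (PerfRL.policySet S A) π :=
    PerfRL.hasGradientWithinAt_of_expansion (by linarith) hπ fun π' hπ' => (hg₀ π' hπ').2
  refine ⟨fun u hu => ⟨(hmem_p u hu).1, (hmem_m u hu).1⟩, ⟨g₀, hgrad⟩, ?_⟩
  intro g hg N η εV hN hη hη1 hεV Ξ _ ν _ Vhat hVhat herr Ω _ P _ u ξp ξm hu hind hξp hξm hup hum
  refine ⟨?_, fun hNη => PerfRL.errorBound_le_order S A hL0.le hl0.le hδ hδΔ hm1 hεV hη hN hNη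
    hn hc⟩
  -- This is where `|A| ≥ 2` enters: if `L₀` were trivial, the law of `u 0` would be the zero
  -- measure.
  have hnt : Nontrivial (PerfRL.zeroRowSum S A) := by
    by_contra hsub
    rw [not_nontrivial_iff_subsingleton] at hsub
    have h := (hu ⟨0, hN⟩).measure_eq (p := fun _ => True) MeasurableSet.univ
    rw [PerfRL.uniformDirection_eq_zero] at h
    simp at h
  have hA : Nonempty A := ⟨(Classical.arbitrary (S × A)).2⟩
  -- Subtracting the expansions at `π ± δu` cancels `V(π)`. They involve `g₀`, which may be replaced
  -- by the given gradient `g` because `u` lies in `L₀`.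
  have hsymm : ∀ u ∈ PerfRL.unitDirections S A,
      |M.perfValue γ lam (π + δ • u) - M.perfValue γ lam (π - δ • u) - 2 * δ * inner ℝ g u|
        ≤ 2 * (Q / (Δ - δ) * δ ^ 2) := by
    intro u hu
    have h1 := (hg₀ _ (hmem_p u hu)).2
    have h2 := (hg₀ _ (hmem_m u hu)).2
    rw [add_sub_cancel_left, real_inner_smul_right, norm_smul, hu.1, mul_one,
      Real.norm_of_nonneg hδ.le] at h1
    rw [sub_sub_cancel_left, inner_neg_right, norm_neg, real_inner_smul_right, norm_smul, hu.1,
      mul_one, Real.norm_of_nonneg hδ.le] at h2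
    rw [PerfRL.inner_eq_of_hasGradientWithinAt (hδ.trans hδΔ) hπ hg hgrad hu.1.le hu.2]
    rw [abs_le] at h1 h2 ⊢
    constructor <;> linarith [h1.1, h1.2, h2.1, h2.2]
  have hprob := PerfRL.measure_twoPointEstimator_error_ge (K := K / (Δ - δ)) hδ hδΔ (by positivity)
    (by positivity) hπ
    (fun π hπ π' hπ' => by
      obtain ⟨_, h⟩ := hexp M hM hS (Δ - δ) hm π hπ
      exact (h π' hπ').1)
    hsymm hN hη hη1 hVhat herr hu hind hξp hξm hup hum
  refine hprob.trans (measure_mono fun ω hω => ?_)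
  have hcard : (Fintype.card (S × A) : ℝ) = n := by rw [Fintype.card_prod, Nat.cast_mul]
  rw [Set.mem_ofPred_eq, hcard] at hω
  refine hω.trans (PerfRL.le_errorBound hδ hδΔ hεV hη hη1 hN hn ?_ hK.le hQ.le
    ?_ ?_)
  · rw [PerfRL.finrank_zeroRowSum, hn]
    exact mul_le_mul_of_nonneg_left (by linarith) (Nat.cast_nonneg _)
  · rw [hL]
    gcongr
    linarith
  · rw [hl]
    gcongr
    linarith
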